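/- Let $N\ge 2$ and let $\Omega\subset\mathbb{R}^N$ be a bounded open set. For $0<s<1<p<N$ put $$c_{N,s,p}:=\frac{s\,2^{2s}\,\Gamma\!\left(\frac{ps+p+N-2}{2}\right)}{\pi^{N/2}\,\Gamma(1-s)},$$ and for measurable $u:\mathbb{R}^N\to\mathbb{R}$ let $[u]_{s,p}\in[0,\infty]$ be $$[u]_{0,p}:=\|u\|_{L^p(\mathbb{R}^N)},\qquad [u]_{s,p}:=\left(c_{N,s,p}\iint_{\mathbb{R}^{2N}}\frac{|u(x)-u(y)|^p}{|x-y|^{N+sp}}\,dx\,dy\right)^{1/p}\ (0<s<1),\qquad [u]_{1,p}:=\|\nabla u\|_{L^p(\mathbb{R}^N)},$$ where $\nabla u$ is the weak gradient and $[u]_{1,p}:=\infty$ if $u$ has no weak gradient in $L^1_{\rm loc}$. There exists a constant $c_0=c_0(N,\Omega)>0$ with the following property. Let $\overline s\in(0,1]$, let $\mu_s^+,\mu_s^-$ be finite Borel measures on $[0,1]$ and $\mu_p$ a finite Borel measure on $(1,N)$, and set $$\mu^+:=\mu_s^+\times\mu_p,\qquad \mu^-:=\mu_s^-\times\mu_p,\qquad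 \mu:=\mu^+-\mu^- .$$ Assume that $\mu^+([\overline s,1]\times(1,N))>0$ and $\mu^-([\overline s,1]\times(1,N))=0$, and that for some $\gamma\ge 0$ and $\delta,\eta>0$, $$\mu_s^-([0,\overline s))\le\gamma\,\mu_s^+([\overline s,1])\qquad\text{and}\qquad \operatorname{supp}(\mu_p)\subset[1+\delta,N-\eta].$$ Let $\mathcal{X}_\mu(\Omega)$ be the completion of $C_c^\infty(\Omega)$ with respect to the norm $\|u\|_\mu:=\iint_{[0,1]\times(1,N)}[u]_{s,p}\,d\mu^+(s,p)$, that is, the space of measurable functions $u$ on $\mathbb{R}^N$ with $u=0$ a.e. outside $\Omega$ for which there are $\varphi_k\in C_c^\infty(\Omega)$ with $\|\varphi_k-u\|_\mu\to0$. Then, for every $u\in\mathcal{X}_\mu(\Omega)$, as an inequality in $[0,\infty]$, $$\iint_{[0,\overline s)\times(1,N)}[u]_{s,p}^p\,d\mu^-(s,p)\le c_0\,\gamma\iint_{[\overline s,1]\times(1,N)}[u]_{s,p}^p\,d\mu(s,p).$$ -/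

import Mathlib

open MeasureTheory Set Filter Topology
open scoped ENNReal ContDiff

noncomputable section

/-- The normalizing constant
`c_{N,s,p} = s 2^{2s} Γ((ps+p+N-2)/2) / (π^{N/2} Γ(1-s))`, used for `0 < s < 1`, `1 < p < N`. -/
def cNsp (N : ℕ) (s p : ℝ) : ℝ :=
  s * (2 : ℝ) ^ (2 * s) * Real.Gamma ((p * s + p + (N : ℝ) - 2) / 2) /
    (Real.pi ^ ((N : ℝ) / 2) * Real.Gamma (1 - s))

/-- `φ ∈ C_c^∞(Ω)`, as a function on all of `ℝ^N`. -/
def IsTestFunction {N : ℕ} (Ω : Set (EuclideanSpace ℝ (Fin N)))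
    (φ : EuclideanSpace ℝ (Fin N) → ℝ) : Prop :=
  ContDiff ℝ ∞ φ ∧ HasCompactSupport φ ∧ tsupport φ ⊆ Ω

/-- `G ∈ L^1_loc(ℝ^N; ℝ^N)` is the weak gradient of `u ∈ L^1_loc(ℝ^N)` on the whole space. -/
def HasWeakGradient {N : ℕ} (u : EuclideanSpace ℝ (Fin N) → ℝ)
    (G : EuclideanSpace ℝ (Fin N) → EuclideanSpace ℝ (Fin N)) : Prop :=
  LocallyIntegrable u volume ∧ LocallyIntegrable G volume ∧
    ∀ φ : EuclideanSpace ℝ (Fin N) → ℝ, IsTestFunction univ φ →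
      ∀ v : EuclideanSpace ℝ (Fin N),
        ∫ x, u x * fderiv ℝ φ x v = - ∫ x, φ x * inner ℝ (G x) v

/-- `‖∇u‖_{L^p(ℝ^N)}` for the weak gradient, with value `∞` if `u` has none. The weak gradient is
unique up to null sets, so the infimum runs over one value or over none. -/
def gradNorm {N : ℕ} (p : ℝ) (u : EuclideanSpace ℝ (Fin N) → ℝ) : ℝ≥0∞ :=
  ⨅ (G : EuclideanSpace ℝ (Fin N) → EuclideanSpace ℝ (Fin N)) (_ : HasWeakGradient u G),
    eLpNorm G (ENNReal.ofReal p) volume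

/-- The quantity `[u]_{s,p} ∈ [0,∞]`, for `0 ≤ s ≤ 1` and `1 < p`. -/
def fracSeminorm {N : ℕ} (s p : ℝ) (u : EuclideanSpace ℝ (Fin N) → ℝ) : ℝ≥0∞ :=
  if s = 0 then eLpNorm u (ENNReal.ofReal p) volume
  else if s = 1 then gradNorm p u
  else
    (ENNReal.ofReal (cNsp N s p) *
      ∫⁻ z : EuclideanSpace ℝ (Fin N) × EuclideanSpace ℝ (Fin N),
        ENNReal.ofReal (|u z.1 - u z.2| ^ p / ‖z.1 - z.2‖ ^ ((N : ℝ) + s * p))) ^ (1 / p)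

/-- `‖u‖_μ = ∬_Σ [u]_{s,p} dμ⁺(s,p)` with `Σ = [0,1] × (1,N)`; the variables are `(s,p)`. -/
def muNorm {N : ℕ} (μplus : Measure (ℝ × ℝ)) (u : EuclideanSpace ℝ (Fin N) → ℝ) : ℝ≥0∞ :=
  ∫⁻ z in Icc (0 : ℝ) 1 ×ˢ Ioo (1 : ℝ) N, fracSeminorm z.1 z.2 u ∂μplus

/-- The space `X_μ(Ω)`, the completion of `C_c^∞(Ω)` for `‖·‖_μ`, realized as a space of
functions: those vanishing a.e. outside `Ω` that are limits in `‖·‖_μ` of functions in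
`C_c^∞(Ω)`. (Its elements are representatives; functions that agree a.e. are identified.) -/
def spaceX {N : ℕ} (Ω : Set (EuclideanSpace ℝ (Fin N))) (μplus : Measure (ℝ × ℝ)) :
    Set (EuclideanSpace ℝ (Fin N) → ℝ) :=
  {u | AEStronglyMeasurable u volume ∧ (∀ᵐ x ∂volume, x ∉ Ω → u x = 0) ∧
    ∃ φ : ℕ → EuclideanSpace ℝ (Fin N) → ℝ, (∀ k, IsTestFunction Ω (φ k)) ∧
      Tendsto (fun k => muNorm μplus (φ k - u)) atTop (𝓝 0)}

/-- The integral over `A` of a `[0,∞]`-valued function against a signed measure `μ`: the difference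
of the integrals against the two parts of the Jordan decomposition of `μ`. It is meaningful
as soon as one of the two is finite. -/
def signedIntegral {α : Type*} [MeasurableSpace α] (μ : SignedMeasure α) (A : Set α)
    (f : α → ℝ≥0∞) : EReal :=
  ((∫⁻ z in A, f z ∂μ.toJordanDecomposition.posPart : ℝ≥0∞) : EReal) -
    ((∫⁻ z in A, f z ∂μ.toJordanDecomposition.negPart : ℝ≥0∞) : EReal)

end

/-! ### Dyadic sums -/

/-! The core is a comparison at fixed `p`: if `u` vanishes outside a ball of radius `R ≥ 1`, then
`[u]_{s,p}^p ≤ C [u]_{S,p}^p` for `0 ≤ s < S ≤ 1`, with `C` depending only on `N` and `R`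
(`exists_fracSeminorm_rpow_le`). The product structure then allows integration in `p` of the
supremum over `s < sbar`, and the mass condition on the `s`-factors supplies `γ`
(`setLIntegral_prod_le_of_le`).

For the comparison, put `W(h) = ‖u(· + h) - u‖_p^p`. The Gagliardo integral is `∫ W(h) |h|^{-N-sp}
dh`, which up to constants is `∑ 2^{-ksp} V k` over dyadic shells, `V k` being the mean of `W` at
scale `2^k` up to normalization. Three facts about `V` suffice. The triangle inequality gives `V
(k+1) ≤ 2^p V k`. For `k ≥ 0` the supports of `u` and its translate are disjoint, so `V k ≥ a`,
where `a` is `‖u‖_p^p` times the volume of the annulus. Always `V k ≤ 2^N a`.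

The constant `c_{N,s,p}` is comparable to `s(1-s)`. The factor `s` normalizes the geometric series
over large scales, whose value is then comparable to `a`. The factor `1-s` normalizes the series
over small scales, a geometric average with ratio `q = 2^{-p(1-s)}` of the increasing sequence
`2^{np} V (-n)`; such an average increases with `q`, hence with `s`
(`one_sub_mul_tsum_pow_mul_mono`). The remaining multiple of `a` is absorbed by `le_mul_dyadicSum`.
For `S = 1`, the bound `W(h) ≤ |h|^p ‖∇u‖_p^p` bounds the whole sequence `2^{np} V (-n)`. -/

lemma half_le_one_sub_two_rpow_neg {p t : ℝ} (hp : 1 ≤ p) (ht0 : 0 ≤ t) (ht1 : t ≤ 1) :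
    t / 2 ≤ 1 - (2 : ℝ) ^ (-(p * t)) := by
  have h1 : (2 : ℝ) ^ (-(p * t)) ≤ (2 : ℝ) ^ (-t) := by
    apply Real.rpow_le_rpow_of_exponent_le one_le_two
    nlinarith
  have h2 : ((1 : ℝ) + (-1 / 2)) ^ t ≤ 1 + t * (-1 / 2) :=
    rpow_one_add_le_one_add_mul_self (by norm_num) ht0 ht1
  have h3 : (2 : ℝ) ^ (-t) = ((1 : ℝ) + (-1 / 2)) ^ t := by
    rw [show ((1 : ℝ) + (-1 / 2)) = 2⁻¹ by norm_num, Real.inv_rpow (by norm_num),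
      Real.rpow_neg (by norm_num)]
  linarith

lemma one_sub_two_rpow_neg_le {p t M : ℝ} (hpM : p ≤ M) (hp : 0 ≤ p) (ht0 : 0 ≤ t) :
    1 - (2 : ℝ) ^ (-(p * t)) ≤ M * t := by
  have h1 : 1 - Real.log 2 * (p * t) ≤ (2 : ℝ) ^ (-(p * t)) := by
    rw [Real.rpow_def_of_pos (by norm_num)]
    have := Real.one_sub_le_exp_neg (Real.log 2 * (p * t))
    rwa [mul_neg]
  have h2 : Real.log 2 ≤ 1 := by linarith [Real.log_two_lt_d9]
  have h3 : 0 ≤ p * t := mul_nonneg hp ht0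
  nlinarith

lemma ofReal_two_rpow (x : ℝ) : ENNReal.ofReal ((2 : ℝ) ^ x) = (2 : ℝ≥0∞) ^ x := by
  rw [← ENNReal.ofReal_rpow_of_pos (by norm_num)]; simp

/-- With the next lemma, this exchanges `t` for the geometric normalization `1 - 2^{-pt}` at a cost
uniform in `p ∈ [1,N]`. It is applied with `t = s` at large scales and `t = 1 - s` at small ones. -/
lemma ofReal_le_two_mul_one_sub {p t : ℝ} (hp : 1 ≤ p) (ht0 : 0 ≤ t) (ht1 : t ≤ 1) :
    ENNReal.ofReal t ≤ 2 * (1 - (2 : ℝ≥0∞) ^ (-(p * t))) := by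
  rw [← ofReal_two_rpow, ← ENNReal.ofReal_one, ← ENNReal.ofReal_sub _ (by positivity),
    show (2 : ℝ≥0∞) = ENNReal.ofReal 2 by simp, ← ENNReal.ofReal_mul (by norm_num)]
  apply ENNReal.ofReal_le_ofReal
  linarith [half_le_one_sub_two_rpow_neg hp ht0 ht1]

lemma one_sub_le_natCast_mul_ofReal {N : ℕ} {p t : ℝ} (hp : 0 ≤ p) (hpN : p ≤ N) (ht0 : 0 ≤ t) :
    1 - (2 : ℝ≥0∞) ^ (-(p * t)) ≤ N * ENNReal.ofReal t := by
  rw [← ofReal_two_rpow, ← ENNReal.ofReal_one, ← ENNReal.ofReal_sub _ (by positivity),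
    ← ENNReal.ofReal_natCast, ← ENNReal.ofReal_mul (by positivity)]
  exact ENNReal.ofReal_le_ofReal (one_sub_two_rpow_neg_le hpN hp ht0)

/-- Summation by parts for geometric averages of a monotone sequence. -/
lemma one_sub_mul_tsum_pow_mul {f : ℕ → ℝ≥0∞} (hf : Monotone f) {q : ℝ≥0∞} (hq : q < 1) :
    (1 - q) * ∑' n, q ^ n * f n = ∑' j, q ^ j * (f j - if j = 0 then 0 else f (j - 1)) := by
  set g : ℕ → ℝ≥0∞ := fun j => f j - if j = 0 then 0 else f (j - 1) with hg
  -- Monotonicity makes the truncated differences `g` genuine increments, so `f` telescopes and the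
  -- double sum can be exchanged.
  have hfg : ∀ n, f n = ∑ j ∈ Finset.range (n + 1), g j := by
    intro n
    induction n with
    | zero => simp [hg]
    | succ n ih =>
      rw [Finset.sum_range_succ, ← ih]
      simp only [hg, Nat.succ_ne_zero, if_false, Nat.add_sub_cancel]
      exact (add_tsub_cancel_of_le (hf n.le_succ)).symm
  have h1 : ∑' n, q ^ n * f n = ∑' j, ∑' n, if j ≤ n then q ^ n * g j else 0 := by
    rw [ENNReal.tsum_comm]
    congr 1; ext n
    rw [hfg n, Finset.mul_sum, tsum_eq_sum (s := Finset.range (n + 1))]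
    · refine Finset.sum_congr rfl fun j hj => ?_
      rw [if_pos (by simpa [Nat.lt_succ_iff] using hj)]
    · intro j hj
      rw [if_neg (by simpa [Nat.lt_succ_iff] using hj)]
  have h2 : ∀ j, (∑' n, if j ≤ n then q ^ n * g j else 0) = (1 - q)⁻¹ * (q ^ j * g j) := by
    intro j
    rw [← ENNReal.tsum_geometric, ← ENNReal.tsum_mul_right,
      ← ENNReal.summable.sum_add_tsum_nat_add' (k := j)]
    rw [Finset.sum_eq_zero, zero_add]
    · congr 1; ext n
      rw [if_pos (by omega), pow_add, mul_assoc]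
    · intro n hn
      rw [if_neg (by simpa using hn)]
  have h0 : 1 - q ≠ 0 := by simpa [tsub_eq_zero_iff_le] using hq
  rw [h1]
  simp_rw [h2]
  rw [ENNReal.tsum_mul_left, ← mul_assoc, ENNReal.mul_inv_cancel h0 (by simp), one_mul]

/-- After summation by parts the ratio enters only through `q ^ j`, multiplying nonnegative
increments. -/
lemma one_sub_mul_tsum_pow_mul_mono {f : ℕ → ℝ≥0∞} (hf : Monotone f) {q r : ℝ≥0∞}
    (hqr : q ≤ r) (hr : r < 1) :
    (1 - q) * ∑' n, q ^ n * f n ≤ (1 - r) * ∑' n, r ^ n * f n := by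
  rw [one_sub_mul_tsum_pow_mul hf (hqr.trans_lt hr), one_sub_mul_tsum_pow_mul hf hr]
  gcongr

lemma le_one_sub_mul_tsum_pow_mul {f : ℕ → ℝ≥0∞} (hf : Monotone f) {q : ℝ≥0∞} (hq : q < 1) :
    f 0 ≤ (1 - q) * ∑' n, q ^ n * f n := by
  rw [one_sub_mul_tsum_pow_mul hf hq]
  refine le_trans ?_ (ENNReal.le_tsum 0)
  simp

lemma one_sub_mul_tsum_pow_mul_le {f : ℕ → ℝ≥0∞} {M : ℝ≥0∞} (hf : ∀ n, f n ≤ M)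
    (q : ℝ≥0∞) (hq : q < 1) : (1 - q) * ∑' n, q ^ n * f n ≤ M := by
  have h0 : 1 - q ≠ 0 := by simpa [tsub_eq_zero_iff_le] using hq
  calc (1 - q) * ∑' n, q ^ n * f n ≤ (1 - q) * ∑' n, q ^ n * M := by
        gcongr with n; exact hf n
    _ = M := by
        rw [ENNReal.tsum_mul_right, ENNReal.tsum_geometric, ← mul_assoc,
          ENNReal.mul_inv_cancel h0 (by simp), one_mul]

/-- The sum `∑ 2^{-ksp} V k` over all dyadic scales `k`. -/
noncomputable def dyadicSum (V : ℤ → ℝ≥0∞) (s p : ℝ) : ℝ≥0∞ :=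
  ∑' k : ℤ, (2 : ℝ≥0∞) ^ (-(k * (p * s))) * V k

/-- The rescaled sequence `2^{np} V (-n)`. -/
noncomputable def smallScales (V : ℤ → ℝ≥0∞) (p : ℝ) (n : ℕ) : ℝ≥0∞ :=
  (2 : ℝ≥0∞) ^ (n * p) * V (-n)

lemma two_rpow_add (x y : ℝ) : (2 : ℝ≥0∞) ^ (x + y) = 2 ^ x * 2 ^ y :=
  ENNReal.rpow_add x y (by simp) (by simp)

lemma two_rpow_neg_lt_one {x : ℝ} (hx : 0 < x) : (2 : ℝ≥0∞) ^ (-x) < 1 :=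
  ENNReal.rpow_lt_one_of_one_lt_of_neg (by norm_num) (by linarith)

/-- The weight `2^{np}` exactly offsets the factor `2^p` lost in each doubling of scale. -/
lemma monotone_smallScales {V : ℤ → ℝ≥0∞} {p : ℝ} (hV : ∀ k, V (k + 1) ≤ 2 ^ p * V k) :
    Monotone (smallScales V p) := by
  refine monotone_nat_of_le_succ fun n => ?_
  unfold smallScales
  have := hV (-(n + 1 : ℕ))
  rw [show (-((n + 1 : ℕ) : ℤ) + 1) = -(n : ℤ) by push_cast; ring] at this
  calc (2 : ℝ≥0∞) ^ (n * p) * V (-n) ≤ (2 : ℝ≥0∞) ^ (n * p) * (2 ^ p * V (-(n + 1 : ℕ))) := by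
        gcongr
    _ = _ := by
        rw [← mul_assoc, ← two_rpow_add]; congr 2; push_cast; ring

/-- Splitting the dyadic sum into small and large scales. -/
lemma dyadicSum_eq (V : ℤ → ℝ≥0∞) (s p : ℝ) :
    dyadicSum V s p = ∑' n : ℕ, ((2 : ℝ≥0∞) ^ (-(p * (1 - s)))) ^ n * smallScales V p n +
      ∑' n : ℕ, ((2 : ℝ≥0∞) ^ (-(p * s))) ^ (n + 1) * V (n + 1) := by
  unfold dyadicSum
  rw [← (Equiv.neg ℤ).tsum_eq, tsum_of_nat_of_neg_add_one ENNReal.summable ENNReal.summable]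
  congr 1
  · congr 1; ext n
    unfold smallScales
    rw [← ENNReal.rpow_natCast, ← ENNReal.rpow_mul, ← mul_assoc (2 ^ _), ← two_rpow_add]
    simp only [Equiv.neg_apply]
    congr 2; push_cast; ring
  · congr 1; ext n
    rw [← ENNReal.rpow_natCast, ← ENNReal.rpow_mul]
    simp only [Equiv.neg_apply, neg_neg]
    congr 2; push_cast; ring

section Dyadic

variable {N : ℕ} {V : ℤ → ℝ≥0∞} {a : ℝ≥0∞} {s S p : ℝ}

lemma ofReal_mul_large_le (hp : 1 ≤ p) (hs0 : 0 < s) (hs1 : s ≤ 1)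
    (hVa : ∀ n : ℕ, V n ≤ 2 ^ N * a) :
    ENNReal.ofReal s * ∑' n : ℕ, ((2 : ℝ≥0∞) ^ (-(p * s))) ^ (n + 1) * V (n + 1) ≤
      2 * 2 ^ N * a := by
  set q := (2 : ℝ≥0∞) ^ (-(p * s))
  have hq : q < 1 := two_rpow_neg_lt_one (by positivity)
  calc _ ≤ (2 * (1 - q)) * ∑' n : ℕ, q ^ n * V (n + 1) := by
        gcongr ?_ * ∑' n : ℕ, ?_ * _ with n
        · exact ofReal_le_two_mul_one_sub hp hs0.le hs1
        · exact pow_le_pow_right_of_le_one' hq.le n.le_succ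
    _ = 2 * ((1 - q) * ∑' n : ℕ, q ^ n * V (n + 1)) := by rw [mul_assoc]
    _ ≤ 2 * (2 ^ N * a) := by
        gcongr 2 * ?_
        exact one_sub_mul_tsum_pow_mul_le (fun n => by simpa using hVa (n + 1)) q hq
    _ = _ := by rw [mul_assoc]

lemma le_ofReal_mul_large (hp : 1 ≤ p) (hpN : p ≤ N) (hs0 : 0 < s) (hs1 : s ≤ 1)
    (haV : ∀ n : ℕ, a ≤ V n) :
    a ≤ N * 2 ^ N *
      (ENNReal.ofReal s * ∑' n : ℕ, ((2 : ℝ≥0∞) ^ (-(p * s))) ^ (n + 1) * V (n + 1)) := by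
  set q := (2 : ℝ≥0∞) ^ (-(p * s)) with hqdef
  have hq : q < 1 := two_rpow_neg_lt_one (by positivity)
  have h0 : 1 - q ≠ 0 := by simpa [tsub_eq_zero_iff_le] using hq
  -- The large-scale sum starts with `q`, not `1`; the factor `2 ^ N` restores the missing power
  -- because `p * s ≤ N`.
  have hq2 : 1 ≤ 2 ^ N * q := by
    rw [← ENNReal.rpow_natCast, hqdef, ← two_rpow_add]
    rw [← ENNReal.rpow_zero (x := 2)]
    apply ENNReal.rpow_le_rpow_of_exponent_le (by norm_num)
    nlinarith
  calc a = 1 * ((1 - q) * ((1 - q)⁻¹ * a)) := by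
        rw [← mul_assoc (1 - q), ENNReal.mul_inv_cancel h0 (by simp), one_mul, one_mul]
    _ ≤ (2 ^ N * q) * ((N * ENNReal.ofReal s) * ((1 - q)⁻¹ * a)) := by
        gcongr
        exact one_sub_le_natCast_mul_ofReal (by linarith) hpN hs0.le
    _ = N * 2 ^ N * (ENNReal.ofReal s * (q * ((1 - q)⁻¹ * a))) := by ring
    _ ≤ _ := by
        gcongr
        rw [← ENNReal.tsum_geometric, ← ENNReal.tsum_mul_right, ← ENNReal.tsum_mul_left]
        gcongr ∑' n : ℕ, ?_ with n
        rw [pow_succ', mul_assoc]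
        gcongr
        exact_mod_cast haV (n + 1)

lemma le_ofReal_mul_small (hp : 1 ≤ p) (hpN : p ≤ N) (hS1 : S < 1)
    (hV : ∀ k, V (k + 1) ≤ 2 ^ p * V k) (haV : ∀ n : ℕ, a ≤ V n) :
    a ≤ N * (ENNReal.ofReal (1 - S) *
      ∑' n : ℕ, ((2 : ℝ≥0∞) ^ (-(p * (1 - S)))) ^ n * smallScales V p n) := by
  have hq : (2 : ℝ≥0∞) ^ (-(p * (1 - S))) < 1 :=
    two_rpow_neg_lt_one (mul_pos (by linarith) (by linarith))
  calc a ≤ smallScales V p 0 := by simpa [smallScales] using haV 0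
    _ ≤ _ := le_one_sub_mul_tsum_pow_mul (monotone_smallScales hV) hq
    _ ≤ (N * ENNReal.ofReal (1 - S)) * _ := by
        gcongr
        exact one_sub_le_natCast_mul_ofReal (by linarith) hpN (by linarith)
    _ = _ := by rw [mul_assoc]

/-- Small and large scales each dominate `a`, after multiplication by `1 - S` and `S` respectively.
Writing `a = (1 - S) a + S a` and using the large scales in the first term and the small scales in
the second produces the common factor `S (1 - S)`, with no loss as `S` tends to `0` or `1`. -/
lemma le_mul_dyadicSum (hp : 1 ≤ p) (hpN : p ≤ N) (hS0 : 0 < S) (hS1 : S < 1)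
    (hV : ∀ k, V (k + 1) ≤ 2 ^ p * V k) (haV : ∀ n : ℕ, a ≤ V n) :
    a ≤ N * 2 ^ N * (ENNReal.ofReal (S * (1 - S)) * dyadicSum V S p) := by
  rw [dyadicSum_eq, ENNReal.ofReal_mul hS0.le]
  have h1 := le_ofReal_mul_large (V := V) hp hpN hS0 hS1.le haV
  have h2 := le_ofReal_mul_small hp hpN hS1 hV haV
  set X := ∑' n : ℕ, ((2 : ℝ≥0∞) ^ (-(p * (1 - S)))) ^ n * smallScales V p n
  set Y := ∑' n : ℕ, ((2 : ℝ≥0∞) ^ (-(p * S))) ^ (n + 1) * V (n + 1)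
  set t := ENNReal.ofReal S
  set t' := ENNReal.ofReal (1 - S)
  have ht : t' + t = 1 := by
    rw [← ENNReal.ofReal_add (by linarith) hS0.le]; simp
  calc a = t' * a + t * a := by rw [← add_mul, ht, one_mul]
    _ ≤ t' * (N * 2 ^ N * (t * Y)) + t * (N * 1 * (t' * X)) := by
        rw [mul_one]; gcongr
    _ ≤ t' * (N * 2 ^ N * (t * Y)) + t * (N * 2 ^ N * (t' * X)) := by
        gcongr
        exact one_le_pow₀ (by norm_num)
    _ = _ := by ring

/-- Small scales are compared by monotonicity of geometric averages, which gives `2 * N`. Large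
scales at order `s` cost at most `2 * 2 ^ N * a`, and `a` is absorbed into the sum at order `S` by
`le_mul_dyadicSum`. -/
lemma ofReal_mul_dyadicSum_le (hp : 1 ≤ p) (hpN : p ≤ N) (hs0 : 0 < s) (hsS : s ≤ S) (hS1 : S < 1)
    (hV : ∀ k, V (k + 1) ≤ 2 ^ p * V k) (haV : ∀ n : ℕ, a ≤ V n)
    (hVa : ∀ n : ℕ, V n ≤ 2 ^ N * a) :
    ENNReal.ofReal (s * (1 - s)) * dyadicSum V s p ≤
      (2 * N + 2 * 2 ^ N * (N * 2 ^ N)) * (ENNReal.ofReal (S * (1 - S)) * dyadicSum V S p) := by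
  have h1 := ofReal_mul_large_le hp hs0 (hsS.trans hS1.le) hVa
  have h2 := le_mul_dyadicSum hp hpN (hs0.trans_le hsS) hS1 hV haV
  have h3 : ENNReal.ofReal (1 - s) *
        ∑' n : ℕ, ((2 : ℝ≥0∞) ^ (-(p * (1 - s)))) ^ n * smallScales V p n ≤
      2 * N * (ENNReal.ofReal (1 - S) *
        ∑' n : ℕ, ((2 : ℝ≥0∞) ^ (-(p * (1 - S)))) ^ n * smallScales V p n) := by
    calc _ ≤ (2 * (1 - (2 : ℝ≥0∞) ^ (-(p * (1 - s))))) * _ := by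
          gcongr
          exact ofReal_le_two_mul_one_sub hp (by linarith) (by linarith)
      _ ≤ 2 * ((1 - (2 : ℝ≥0∞) ^ (-(p * (1 - S)))) *
            ∑' n : ℕ, ((2 : ℝ≥0∞) ^ (-(p * (1 - S)))) ^ n * smallScales V p n) := by
          rw [mul_assoc]
          gcongr 2 * ?_
          apply one_sub_mul_tsum_pow_mul_mono (monotone_smallScales hV)
          · apply ENNReal.rpow_le_rpow_of_exponent_le (by norm_num)
            nlinarith
          · exact two_rpow_neg_lt_one (mul_pos (by linarith) (by linarith))
      _ ≤ 2 * ((N * ENNReal.ofReal (1 - S)) * _) := by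
          gcongr
          exact one_sub_le_natCast_mul_ofReal (by linarith) hpN (by linarith)
      _ = _ := by ring
  rw [dyadicSum_eq V s p]
  have h4 : ENNReal.ofReal (S * (1 - S)) *
      (∑' n : ℕ, ((2 : ℝ≥0∞) ^ (-(p * (1 - S)))) ^ n * smallScales V p n) ≤
      ENNReal.ofReal (S * (1 - S)) * dyadicSum V S p := by
    rw [dyadicSum_eq V S p]; gcongr; exact le_self_add
  set Z := ENNReal.ofReal (S * (1 - S)) * dyadicSum V S p
  set X := ∑' n : ℕ, ((2 : ℝ≥0∞) ^ (-(p * (1 - s)))) ^ n * smallScales V p n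
  set Y := ∑' n : ℕ, ((2 : ℝ≥0∞) ^ (-(p * s))) ^ (n + 1) * V (n + 1)
  set X' := ∑' n : ℕ, ((2 : ℝ≥0∞) ^ (-(p * (1 - S)))) ^ n * smallScales V p n
  rw [ENNReal.ofReal_mul hs0.le, mul_add]
  have h5 : ENNReal.ofReal (1 - s) ≤ 1 := by
    rw [← ENNReal.ofReal_one]; exact ENNReal.ofReal_le_ofReal (by linarith)
  calc _ = ENNReal.ofReal s * (ENNReal.ofReal (1 - s) * X) +
        ENNReal.ofReal (1 - s) * (ENNReal.ofReal s * Y) := by ring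
    _ ≤ ENNReal.ofReal S * (2 * N * (ENNReal.ofReal (1 - S) * X')) +
        1 * (2 * 2 ^ N * (N * 2 ^ N * Z)) := by
        gcongr ?_ + ?_ * ?_
        · gcongr
        · exact h1.trans (by gcongr)
    _ = 2 * N * (ENNReal.ofReal (S * (1 - S)) * X') + 2 * 2 ^ N * (N * 2 ^ N) * Z := by
        rw [ENNReal.ofReal_mul (hs0.trans_le hsS).le]; ring
    _ ≤ 2 * N * Z + 2 * 2 ^ N * (N * 2 ^ N) * Z := by gcongr
    _ = _ := by rw [add_mul]

/-- This serves the endpoint of order one, where `M` comes from the gradient instead of a dyadic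
sum. -/
lemma ofReal_mul_dyadicSum_le_of_bdd {M : ℝ≥0∞} (hp : 1 ≤ p) (hs0 : 0 < s)
    (hs1 : s < 1) (hM : ∀ n, smallScales V p n ≤ M) (haM : a ≤ M)
    (hVa : ∀ n : ℕ, V n ≤ 2 ^ N * a) :
    ENNReal.ofReal (s * (1 - s)) * dyadicSum V s p ≤ (2 + 2 * 2 ^ N) * M := by
  have h1 := ofReal_mul_large_le hp hs0 hs1.le hVa
  have h3 : ENNReal.ofReal (1 - s) *
        ∑' n : ℕ, ((2 : ℝ≥0∞) ^ (-(p * (1 - s)))) ^ n * smallScales V p n ≤ 2 * M := by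
    calc _ ≤ (2 * (1 - (2 : ℝ≥0∞) ^ (-(p * (1 - s))))) * _ := by
          gcongr
          exact ofReal_le_two_mul_one_sub hp (by linarith) (by linarith)
      _ ≤ _ := by
          rw [mul_assoc]
          gcongr 2 * ?_
          exact one_sub_mul_tsum_pow_mul_le hM _
            (two_rpow_neg_lt_one (mul_pos (by linarith) (by linarith)))
  rw [dyadicSum_eq V s p]
  set X := ∑' n : ℕ, ((2 : ℝ≥0∞) ^ (-(p * (1 - s)))) ^ n * smallScales V p n
  set Y := ∑' n : ℕ, ((2 : ℝ≥0∞) ^ (-(p * s))) ^ (n + 1) * V (n + 1)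
  rw [ENNReal.ofReal_mul hs0.le, mul_add]
  have h5 : ENNReal.ofReal (1 - s) ≤ 1 := by
    rw [← ENNReal.ofReal_one]; exact ENNReal.ofReal_le_ofReal (by linarith)
  have h6 : ENNReal.ofReal s ≤ 1 := by
    rw [← ENNReal.ofReal_one]; exact ENNReal.ofReal_le_ofReal (by linarith)
  calc _ = ENNReal.ofReal s * (ENNReal.ofReal (1 - s) * X) +
        ENNReal.ofReal (1 - s) * (ENNReal.ofReal s * Y) := by ring
    _ ≤ 1 * (2 * M) + 1 * (2 * 2 ^ N * M) := by
        gcongr ?_ * ?_ + ?_ * ?_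
        exact h1.trans (by gcongr)
    _ = _ := by ring

end Dyadic

/-! ### Translation moduli and the Gagliardo integral -/

section Translation

variable {N : ℕ}

/-- The `p`-th power of the `L^p` norm of `u(· + h) - u`. -/
noncomputable def translateMass (u : EuclideanSpace ℝ (Fin N) → ℝ) (p : ℝ)
    (h : EuclideanSpace ℝ (Fin N)) : ℝ≥0∞ :=
  ∫⁻ x, ‖u (x + h) - u x‖ₑ ^ p

/-- The annulus `2R < |h| ≤ 4R`. -/
def annulus (N : ℕ) (R : ℝ) : Set (EuclideanSpace ℝ (Fin N)) := {h | ‖h‖ ∈ Ioc (2 * R) (4 * R)}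

/-- The integral of the translation modulus over `h` in the annulus, at scale `2 ^ k`. -/
noncomputable def shellMass (u : EuclideanSpace ℝ (Fin N) → ℝ) (p R : ℝ) (k : ℤ) : ℝ≥0∞ :=
  ∫⁻ h in annulus N R, translateMass u p ((2 : ℝ) ^ k • h)

lemma measurableSet_annulus (R : ℝ) : MeasurableSet (annulus N R) :=
  measurable_norm measurableSet_Ioc

variable {u : EuclideanSpace ℝ (Fin N) → ℝ} {p s R : ℝ}

lemma enorm_add_rpow_le (a b : ℝ) (hp : 1 ≤ p) :
    ‖a + b‖ₑ ^ p ≤ 2 ^ (p - 1) * (‖a‖ₑ ^ p + ‖b‖ₑ ^ p) :=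
  (ENNReal.rpow_le_rpow (enorm_add_le a b) (by linarith)).trans
    (ENNReal.rpow_add_le_mul_rpow_add_rpow _ _ hp)

lemma two_rpow_sub_one_mul_add_self (a : ℝ≥0∞) : (2 : ℝ≥0∞) ^ (p - 1) * (a + a) = 2 ^ p * a := by
  rw [← two_mul, ← mul_assoc]
  nth_rewrite 2 [← ENNReal.rpow_one 2]
  rw [← two_rpow_add]
  congr 2; ring

lemma translateMass_two_smul_le (hu : Measurable u) (hp : 1 ≤ p) (h : EuclideanSpace ℝ (Fin N)) :
    translateMass u p ((2 : ℝ) • h) ≤ 2 ^ p * translateMass u p h := by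
  have hm : Measurable fun x => ‖u (x + h) - u x‖ₑ ^ p :=
    ((hu.comp (measurable_add_const h)).sub hu).enorm.pow_const p
  have h1 : ∫⁻ x, ‖u (x + h + h) - u (x + h)‖ₑ ^ p = translateMass u p h :=
    lintegral_add_right_eq_self (fun x => ‖u (x + h) - u x‖ₑ ^ p) h
  calc translateMass u p ((2 : ℝ) • h)
      = ∫⁻ x, ‖(u (x + h + h) - u (x + h)) + (u (x + h) - u x)‖ₑ ^ p := by
        unfold translateMass
        congr 1; ext x
        rw [two_smul, ← add_assoc, sub_add_sub_cancel]
    _ ≤ ∫⁻ x, 2 ^ (p - 1) * (‖u (x + h + h) - u (x + h)‖ₑ ^ p + ‖u (x + h) - u x‖ₑ ^ p) :=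
        lintegral_mono fun x => enorm_add_rpow_le _ _ hp
    _ = 2 ^ (p - 1) * (translateMass u p h + translateMass u p h) := by
        rw [lintegral_const_mul' _ _ (by finiteness), lintegral_add_right _ hm, h1]
        rfl
    _ = _ := two_rpow_sub_one_mul_add_self _

lemma translateMass_le (hu : Measurable u) (hp : 1 ≤ p) (h : EuclideanSpace ℝ (Fin N)) :
    translateMass u p h ≤ 2 ^ p * ∫⁻ x, ‖u x‖ₑ ^ p := by
  have h1 : ∫⁻ x, ‖u (x + h)‖ₑ ^ p = ∫⁻ x, ‖u x‖ₑ ^ p :=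
    lintegral_add_right_eq_self (fun x => ‖u x‖ₑ ^ p) h
  calc translateMass u p h
      ≤ ∫⁻ x, 2 ^ (p - 1) * (‖u (x + h)‖ₑ ^ p + ‖u x‖ₑ ^ p) := by
        refine lintegral_mono fun x => ?_
        have := enorm_add_rpow_le (u (x + h)) (-u x) hp
        rwa [enorm_neg, ← sub_eq_add_neg] at this
    _ = 2 ^ (p - 1) * ((∫⁻ x, ‖u x‖ₑ ^ p) + ∫⁻ x, ‖u x‖ₑ ^ p) := by
        rw [lintegral_const_mul' _ _ (by finiteness),
          lintegral_add_right _ (hu.enorm.pow_const p), h1]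
    _ = _ := two_rpow_sub_one_mul_add_self _

/-- A shift longer than the diameter `2 * R` separates the supports: wherever `u x` can be nonzero,
`u (x + h)` vanishes. -/
lemma le_translateMass (hp : 0 < p)
    (hsupp : ∀ᵐ x : EuclideanSpace ℝ (Fin N), x ∉ Metric.ball 0 R → u x = 0)
    {h : EuclideanSpace ℝ (Fin N)}
    (hh : 2 * R < ‖h‖) : ∫⁻ x, ‖u x‖ₑ ^ p ≤ translateMass u p h := by
  have hsupp' : ∀ᵐ x : EuclideanSpace ℝ (Fin N), x + h ∉ Metric.ball 0 R → u (x + h) = 0 :=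
    (measurePreserving_add_right volume h).quasiMeasurePreserving.ae hsupp
  refine lintegral_mono_ae ?_
  filter_upwards [hsupp, hsupp'] with x h1 h2
  by_cases hx : x ∈ Metric.ball (0 : EuclideanSpace ℝ (Fin N)) R
  · rw [h2, zero_sub, enorm_neg]
    simp only [mem_ball_zero_iff, not_lt] at hx ⊢
    have : ‖h‖ ≤ ‖x + h‖ + ‖x‖ := by simpa using norm_sub_le (x + h) x
    linarith
  · simp [h1 hx, hp]

lemma shellMass_succ_le (hu : Measurable u) (hp : 1 ≤ p) (k : ℤ) :
    shellMass u p R (k + 1) ≤ 2 ^ p * shellMass u p R k := by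
  unfold shellMass
  rw [← lintegral_const_mul' _ _ (by finiteness)]
  refine lintegral_mono fun h => ?_
  rw [zpow_add_one₀ (by norm_num), mul_comm, mul_smul]
  exact translateMass_two_smul_le hu hp _

lemma le_shellMass (hp : 0 < p)
    (hsupp : ∀ᵐ x : EuclideanSpace ℝ (Fin N), x ∉ Metric.ball 0 R → u x = 0) (n : ℕ) :
    volume (annulus N R) * ∫⁻ x, ‖u x‖ₑ ^ p ≤ shellMass u p R n := by
  rw [mul_comm, ← setLIntegral_const]
  refine setLIntegral_mono' (measurableSet_annulus R) fun h hh => ?_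
  refine le_translateMass hp hsupp ?_
  rw [norm_smul, zpow_natCast, norm_pow, Real.norm_ofNat]
  have h1 : (1 : ℝ) ≤ 2 ^ n := one_le_pow₀ (by norm_num)
  nlinarith [hh.1, norm_nonneg h]

lemma shellMass_le (hu : Measurable u) (hp : 1 ≤ p) (hpN : p ≤ N) (k : ℤ) :
    shellMass u p R k ≤ 2 ^ N * (volume (annulus N R) * ∫⁻ x, ‖u x‖ₑ ^ p) := by
  calc shellMass u p R k ≤ ∫⁻ h in annulus N R, 2 ^ (N : ℝ) * ∫⁻ x, ‖u x‖ₑ ^ p := by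
        refine lintegral_mono fun h => (translateMass_le hu hp _).trans ?_
        gcongr
        norm_num
    _ = _ := by
        rw [setLIntegral_const, ENNReal.rpow_natCast]; ring

lemma smallScales_shellMass_le {K : ℝ≥0∞} (hp : 0 ≤ p) (hpN : p ≤ N) (hR : 1 ≤ R)
    (hW : ∀ h, translateMass u p h ≤ ‖h‖ₑ ^ p * K) (n : ℕ) :
    smallScales (shellMass u p R) p n ≤
      volume (annulus N R) * (ENNReal.ofReal (4 * R) ^ N * K) := by
  unfold smallScales shellMass
  rw [← lintegral_const_mul' _ _ (by finiteness), mul_comm (volume _), ← setLIntegral_const]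
  refine setLIntegral_mono' (measurableSet_annulus R) fun h hh => ?_
  calc _ ≤ (2 : ℝ≥0∞) ^ (n * p) * (‖(2 : ℝ) ^ (-n : ℤ) • h‖ₑ ^ p * K) := by gcongr; exact hW _
    _ = ‖h‖ₑ ^ p * K := by
        have h2 : (2 : ℝ≥0∞) ^ (n * p) = ((2 : ℝ≥0∞) ^ n) ^ p := by
          rw [ENNReal.rpow_mul, ENNReal.rpow_natCast]
        have h3 : (2 : ℝ≥0∞) ^ n * ‖(2 : ℝ) ^ (-n : ℤ) • h‖ₑ = ‖h‖ₑ := by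
          have h4 : h = (2 : ℝ) ^ n • ((2 : ℝ) ^ (-n : ℤ) • h) := by
            rw [smul_smul, zpow_neg, zpow_natCast, mul_inv_cancel₀ (by positivity), one_smul]
          conv_rhs => rw [h4, enorm_smul, enorm_pow]
          congr 2
          rw [← ofReal_norm]; simp
        rw [h2, ← mul_assoc, ← ENNReal.mul_rpow_of_nonneg _ _ hp, h3]
    _ ≤ ENNReal.ofReal (4 * R) ^ (N : ℝ) * K := by
        gcongr
        have h5 : ‖h‖ₑ ≤ ENNReal.ofReal (4 * R) := by
          rw [← ofReal_norm]; exact ENNReal.ofReal_le_ofReal hh.2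
        calc ‖h‖ₑ ^ p ≤ ENNReal.ofReal (4 * R) ^ p := by gcongr
          _ ≤ _ := ENNReal.rpow_le_rpow_of_exponent_le
              (by rw [ENNReal.one_le_ofReal]; linarith) hpN
    _ = _ := by rw [ENNReal.rpow_natCast]

/-- The Gagliardo double integral. -/
noncomputable def gagliardo (s p : ℝ) (u : EuclideanSpace ℝ (Fin N) → ℝ) : ℝ≥0∞ :=
  ∫⁻ z : EuclideanSpace ℝ (Fin N) × EuclideanSpace ℝ (Fin N),
    ENNReal.ofReal (|u z.1 - u z.2| ^ p / ‖z.1 - z.2‖ ^ ((N : ℝ) + s * p))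

lemma measurable_gagliardo_integrand (hu : Measurable u) (s p : ℝ) :
    Measurable fun z : EuclideanSpace ℝ (Fin N) × EuclideanSpace ℝ (Fin N) =>
      ENNReal.ofReal (|u z.1 - u z.2| ^ p / ‖z.1 - z.2‖ ^ ((N : ℝ) + s * p)) := by
  have h1 : Measurable fun z : EuclideanSpace ℝ (Fin N) × EuclideanSpace ℝ (Fin N) =>
      |u z.1 - u z.2| ^ p :=
    (((hu.comp measurable_fst).sub (hu.comp measurable_snd)).norm).pow_const p
  have h2 : Measurable fun z : EuclideanSpace ℝ (Fin N) × EuclideanSpace ℝ (Fin N) =>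
      ‖z.1 - z.2‖ ^ ((N : ℝ) + s * p) :=
    ((measurable_fst.sub measurable_snd).norm).pow_const _
  exact (h1.div h2).ennreal_ofReal

lemma gagliardo_eq (hu : Measurable u) (hp : 0 ≤ p) :
    gagliardo s p u = ∫⁻ h : EuclideanSpace ℝ (Fin N),
      translateMass u p h * ENNReal.ofReal (‖h‖ ^ (-((N : ℝ) + s * p))) := by
  have hm := measurable_gagliardo_integrand hu s p
  set F : EuclideanSpace ℝ (Fin N) × EuclideanSpace ℝ (Fin N) → ℝ≥0∞ := fun z =>
      ENNReal.ofReal (|u z.1 - u z.2| ^ p / ‖z.1 - z.2‖ ^ ((N : ℝ) + s * p)) with hF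
  have key : ∀ x h : EuclideanSpace ℝ (Fin N), F (h + x, x) =
      ‖u (x + h) - u x‖ₑ ^ p * ENNReal.ofReal (‖h‖ ^ (-((N : ℝ) + s * p))) := by
    intro x h
    simp only [hF]
    rw [add_sub_cancel_right, Real.rpow_neg (norm_nonneg _), div_eq_mul_inv,
      ENNReal.ofReal_mul (by positivity), ← ENNReal.ofReal_rpow_of_nonneg (abs_nonneg _) hp,
      ← Real.norm_eq_abs, ofReal_norm, add_comm h x]
  have hm2 : Measurable fun z : EuclideanSpace ℝ (Fin N) × EuclideanSpace ℝ (Fin N) =>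
      F (z.2 + z.1, z.1) :=
    hm.comp ((measurable_snd.add measurable_fst).prodMk measurable_fst)
  have e1 : gagliardo s p u = ∫⁻ y, ∫⁻ x, F (x, y) := by
    rw [gagliardo, Measure.volume_eq_prod, lintegral_prod_symm' _ hm]
  have e2 : ∀ y, ∫⁻ x, F (x, y) = ∫⁻ h, F (h + y, y) := fun y =>
    (lintegral_add_right_eq_self (fun x => F (x, y)) y).symm
  have e3 : ∫⁻ y, ∫⁻ h, F (h + y, y) = ∫⁻ h, ∫⁻ y, F (h + y, y) :=
    lintegral_lintegral_swap hm2.aemeasurable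
  rw [e1]
  simp_rw [e2]
  rw [e3]
  simp_rw [key]
  refine lintegral_congr fun h => ?_
  rw [lintegral_mul_const' _ _ ENNReal.ofReal_ne_top, translateMass]

/-- Decomposition of an integral into dyadic shells. -/
lemma lintegral_eq_tsum_shell (hN : 0 < N) (hR : 0 < R) (g : EuclideanSpace ℝ (Fin N) → ℝ≥0∞) :
    ∫⁻ h, g h = ∑' k : ℤ, (2 : ℝ≥0∞) ^ (k * N : ℝ) * ∫⁻ h in annulus N R, g ((2 : ℝ) ^ k • h) := by
  have : Nonempty (Fin N) := ⟨⟨0, hN⟩⟩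
  let B : ℤ → Set (EuclideanSpace ℝ (Fin N)) := fun k =>
    (fun h : EuclideanSpace ℝ (Fin N) => (2 * R)⁻¹ * ‖h‖) ⁻¹' Ioc ((2 : ℝ) ^ k) (2 ^ (k + 1))
  have hBm : ∀ k, MeasurableSet (B k) := fun k =>
    (measurable_norm.const_mul _) measurableSet_Ioc
  have hBd : Pairwise (Function.onFun Disjoint B) := by
    intro i j hij
    refine Disjoint.preimage _ ?_
    have hmono : Monotone fun k : ℤ => (2 : ℝ) ^ k := zpow_right_mono₀ (by norm_num)
    exact hmono.pairwise_disjoint_on_Ioc_succ hij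
  have hU : (⋃ k, B k) =ᵐ[volume] (univ : Set (EuclideanSpace ℝ (Fin N))) := by
    rw [ae_eq_univ]
    refine measure_mono_null (t := {0}) (fun h hh => ?_) (measure_singleton 0)
    by_contra hne
    apply hh
    obtain ⟨n, hn⟩ := exists_mem_Ioc_zpow (x := (2 * R)⁻¹ * ‖h‖) (y := (2 : ℝ))
      (mul_pos (by positivity) (norm_pos_iff.mpr hne)) (by norm_num)
    exact mem_iUnion.mpr ⟨n, hn⟩
  rw [← setLIntegral_univ, ← setLIntegral_congr hU, lintegral_iUnion hBm hBd]
  congr 1; ext k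
  have h2k : (0 : ℝ) < 2 ^ k := by positivity
  have hpre : (fun h : EuclideanSpace ℝ (Fin N) => (2 : ℝ) ^ k • h) ⁻¹' B k = annulus N R := by
    ext h
    simp only [B, annulus, mem_preimage, mem_ofPred_eq, norm_smul, norm_zpow, Real.norm_ofNat,
      mem_Ioc]
    rw [← mul_assoc, mul_comm (2 * R)⁻¹, mul_assoc, zpow_add_one₀ (by norm_num),
      mul_le_mul_iff_right₀ h2k, lt_mul_iff_one_lt_right h2k, inv_mul_le_iff₀ (by positivity),
      lt_inv_mul_iff₀ (by positivity)]
    constructor <;> rintro ⟨h1, h2⟩ <;> constructor <;> linarith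
  have hemb : MeasurableEmbedding fun h : EuclideanSpace ℝ (Fin N) => (2 : ℝ) ^ k • h :=
    measurableEmbedding_const_smul₀ h2k.ne'
  have hmap := Measure.map_addHaar_smul (volume : Measure (EuclideanSpace ℝ (Fin N))) h2k.ne'
  have hint : ∫⁻ h in annulus N R, g ((2 : ℝ) ^ k • h) =
      ENNReal.ofReal |(((2 : ℝ) ^ k) ^ Module.finrank ℝ (EuclideanSpace ℝ (Fin N)))⁻¹| *
        ∫⁻ h in B k, g h := by
    rw [← hpre, ← hemb.lintegral_map, ← hemb.restrict_map, hmap, Measure.restrict_smul,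
      lintegral_smul_measure, smul_eq_mul]
  rw [hint, ← mul_assoc]
  have hone : (2 : ℝ≥0∞) ^ (k * N : ℝ) *
      ENNReal.ofReal |(((2 : ℝ) ^ k) ^ Module.finrank ℝ (EuclideanSpace ℝ (Fin N)))⁻¹| = 1 := by
    rw [finrank_euclideanSpace_fin, abs_of_pos (by positivity), ← Real.rpow_intCast,
      ← Real.rpow_mul_natCast (by norm_num), ← Real.rpow_neg (by norm_num), ofReal_two_rpow,
      ← two_rpow_add]
    simp
  rw [hone, one_mul]

/-- The Jacobian `2^{kN}` of the shell decomposition cancels the `N` in the homogeneity of the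
kernel, leaving `2^{-ksp}`. -/
lemma gagliardo_eq_tsum (hN : 0 < N) (hR : 0 < R) (hu : Measurable u) (hp : 0 ≤ p) :
    gagliardo s p u = ∑' k : ℤ, (2 : ℝ≥0∞) ^ (-(k * (p * s))) *
      ∫⁻ h in annulus N R, translateMass u p ((2 : ℝ) ^ k • h) *
        ENNReal.ofReal (‖h‖ ^ (-((N : ℝ) + s * p))) := by
  rw [gagliardo_eq hu hp, lintegral_eq_tsum_shell hN hR]
  congr 1; ext k
  have h1 : ∀ h : EuclideanSpace ℝ (Fin N),
      ENNReal.ofReal (‖(2 : ℝ) ^ k • h‖ ^ (-((N : ℝ) + s * p))) =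
      (2 : ℝ≥0∞) ^ (-(k * ((N : ℝ) + s * p))) * ENNReal.ofReal (‖h‖ ^ (-((N : ℝ) + s * p))) := by
    intro h
    rw [norm_smul, norm_zpow, Real.norm_ofNat, Real.mul_rpow (by positivity) (norm_nonneg _),
      ENNReal.ofReal_mul (by positivity), ← Real.rpow_intCast, ← Real.rpow_mul (by norm_num),
      ofReal_two_rpow, mul_neg]
  simp_rw [h1, mul_left_comm (translateMass u p _)]
  rw [lintegral_const_mul' _ _ (by finiteness), ← mul_assoc, ← two_rpow_add]
  congr 2; ring

lemma gagliardo_le_dyadicSum (hN : 0 < N) (hR : 1 ≤ R) (hu : Measurable u) (hp : 0 ≤ p)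
    (hs : 0 ≤ s) : gagliardo s p u ≤ dyadicSum (shellMass u p R) s p := by
  rw [gagliardo_eq_tsum hN (by linarith : 0 < R) hu hp]
  unfold dyadicSum shellMass
  gcongr ∑' k : ℤ, _ * ?_ with k
  refine setLIntegral_mono' (measurableSet_annulus R) fun h hh => ?_
  refine mul_le_of_le_one_right' ?_
  rw [ENNReal.ofReal_le_one]
  have := hh.1
  exact Real.rpow_le_one_of_one_le_of_nonpos (by linarith) (by
    have := mul_nonneg hs hp; have : (0 : ℝ) ≤ N := by positivity
    linarith)

lemma dyadicSum_le_gagliardo (hN : 0 < N) (hR : 1 ≤ R) (hu : Measurable u) (hp : 0 ≤ p)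
    (hpN : p ≤ N) (hs : 0 ≤ s) (hs1 : s ≤ 1) :
    dyadicSum (shellMass u p R) s p ≤ ENNReal.ofReal (4 * R) ^ (2 * N) * gagliardo s p u := by
  rw [gagliardo_eq_tsum hN (by linarith : 0 < R) hu hp, ← ENNReal.tsum_mul_left]
  unfold dyadicSum shellMass
  -- On the annulus `1 ≤ |h| ≤ 4R` and `N + sp ≤ 2N`, so the kernel is at least `(4R)^{-2N}`.
  gcongr ∑' k : ℤ, ?_ with k
  rw [mul_left_comm (ENNReal.ofReal _ ^ _)]
  gcongr _ * ?_
  rw [← lintegral_const_mul' _ _ (by finiteness)]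
  refine setLIntegral_mono' (measurableSet_annulus R) fun h hh => ?_
  rw [mul_left_comm]
  refine le_mul_of_one_le_right' ?_
  rw [← ENNReal.ofReal_pow (by linarith), ← ENNReal.ofReal_mul (by positivity),
    ENNReal.one_le_ofReal]
  have h0 : 0 < ‖h‖ := by linarith [hh.1]
  have h1 : 1 ≤ 4 * R := by linarith
  rw [Real.rpow_neg h0.le, ← div_eq_mul_inv, one_le_div (by positivity), ← Real.rpow_natCast]
  have hsp : 0 ≤ s * p := mul_nonneg hs hp
  calc ‖h‖ ^ ((N : ℝ) + s * p) ≤ (4 * R) ^ ((N : ℝ) + s * p) := by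
        gcongr; exact hh.2
    _ ≤ _ := by
        apply Real.rpow_le_rpow_of_exponent_le h1
        push_cast
        nlinarith

lemma volume_annulus_ne_top (R : ℝ) : volume (annulus N R) ≠ ⊤ := by
  refine ((measure_mono fun h hh => ?_).trans_lt
    (measure_closedBall_lt_top (x := (0 : EuclideanSpace ℝ (Fin N))) (r := 4 * R))).ne
  simpa using hh.2

lemma volume_annulus_ne_zero (hN : 0 < N) (hR : 0 < R) : volume (annulus N R) ≠ 0 := by
  have : Nonempty (Fin N) := ⟨⟨0, hN⟩⟩
  obtain ⟨x, hx⟩ := exists_norm_eq (EuclideanSpace ℝ (Fin N)) (c := 3 * R) (by positivity)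
  have hopen : IsOpen {h : EuclideanSpace ℝ (Fin N) | ‖h‖ ∈ Ioo (2 * R) (4 * R)} :=
    isOpen_Ioo.preimage continuous_norm
  refine (lt_of_lt_of_le (hopen.measure_pos volume ⟨x, ?_⟩) (measure_mono fun h hh => ?_)).ne'
  · simp only [mem_ofPred_eq, hx, mem_Ioo]; constructor <;> linarith
  · exact ⟨hh.1, hh.2.le⟩

end Translation

/-! ### Translates of functions with a weak gradient -/

section WeakGradient

variable {N : ℕ} {u f φ : EuclideanSpace ℝ (Fin N) → ℝ}
  {G : EuclideanSpace ℝ (Fin N) → EuclideanSpace ℝ (Fin N)}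

lemma measurePreserving_shear (h : EuclideanSpace ℝ (Fin N)) :
    MeasurePreserving (fun z : ℝ × EuclideanSpace ℝ (Fin N) => (z.1, z.2 + z.1 • h))
      ((volume.restrict (Ioc 0 1)).prod volume) ((volume.restrict (Ioc 0 1)).prod volume) := by
  refine (MeasurePreserving.id (volume.restrict (Ioc (0 : ℝ) 1))).skew_product
    (g := fun (t : ℝ) (x : EuclideanSpace ℝ (Fin N)) => x + t • h) ?_ ?_
  · exact measurable_snd.add (measurable_fst.smul_const h)
  · exact Eventually.of_forall fun t => map_add_right_eq_self volume (t • h)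

lemma integrable_comp_sub_smul_mul (hf : LocallyIntegrable f volume) (hφ : Continuous φ)
    (hφc : HasCompactSupport φ) (h : EuclideanSpace ℝ (Fin N)) :
    Integrable (fun z : ℝ × EuclideanSpace ℝ (Fin N) => φ (z.2 - z.1 • h) * f z.2)
      ((volume.restrict (Ioc 0 1)).prod volume) := by
  obtain ⟨C, hC⟩ := hφc.exists_bound_of_continuous hφ
  obtain ⟨r, hr⟩ := hφc.isCompact.isBounded.subset_closedBall (0 : EuclideanSpace ℝ (Fin N))
  -- This ball contains every translate of the support of `φ` by `t h` with `0 < t ≤ 1`.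
  set K := Metric.closedBall (0 : EuclideanSpace ℝ (Fin N)) (r + ‖h‖)
  have hK : MeasurableSet K := Metric.isClosed_closedBall.measurableSet
  have h1 : Integrable (K.indicator f) volume :=
    (integrable_indicator_iff hK).mpr (hf.integrableOn_isCompact (isCompact_closedBall _ _))
  have h2 : Integrable (fun z : ℝ × EuclideanSpace ℝ (Fin N) => C * K.indicator f z.2)
      ((volume.restrict (Ioc 0 1)).prod volume) := (h1.const_mul C).comp_snd _
  refine h2.mono ?_ ?_
  · refine AEStronglyMeasurable.mul ?_ hf.aestronglyMeasurable.comp_snd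
    exact (hφ.comp (continuous_snd.sub (continuous_fst.smul continuous_const))).aestronglyMeasurable
  · have h3 : ∀ᵐ z ∂((volume.restrict (Ioc (0 : ℝ) 1)).prod
        (volume : Measure (EuclideanSpace ℝ (Fin N)))), z.1 ∈ Ioc (0 : ℝ) 1 :=
      Measure.quasiMeasurePreserving_fst.ae (ae_restrict_mem measurableSet_Ioc)
    filter_upwards [h3] with z hz
    have hC0 : 0 ≤ C := (norm_nonneg _).trans (hC 0)
    by_cases hzK : z.2 ∈ K
    · rw [indicator_of_mem hzK, norm_mul, norm_mul, Real.norm_of_nonneg hC0]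
      gcongr
      exact hC _
    · have : φ (z.2 - z.1 • h) = 0 := by
        apply image_eq_zero_of_notMem_tsupport
        intro hmem
        apply hzK
        have h4 : ‖z.2 - z.1 • h‖ ≤ r := by simpa using hr hmem
        have h5 : ‖z.1 • h‖ ≤ ‖h‖ := by
          rw [norm_smul, Real.norm_of_nonneg hz.1.le]
          exact mul_le_of_le_one_left (norm_nonneg _) hz.2
        have h6 : ‖z.2‖ ≤ ‖z.2 - z.1 • h‖ + ‖z.1 • h‖ := by
          simpa using norm_add_le (z.2 - z.1 • h) (z.1 • h)
        simp only [K, mem_closedBall_zero_iff]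
        linarith
      rw [this, zero_mul, norm_zero]
      exact norm_nonneg _

lemma integrable_mul_comp_add_smul (hf : LocallyIntegrable f volume) (hφ : Continuous φ)
    (hφc : HasCompactSupport φ) (h : EuclideanSpace ℝ (Fin N)) :
    Integrable (fun z : ℝ × EuclideanSpace ℝ (Fin N) => φ z.2 * f (z.2 + z.1 • h))
      ((volume.restrict (Ioc 0 1)).prod volume) := by
  have := (measurePreserving_shear h).integrable_comp_of_integrable
    (integrable_comp_sub_smul_mul hf hφ hφc h)
  simpa [Function.comp_def] using this

lemma locallyIntegrable_integral_segment (hf : LocallyIntegrable f volume)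
    (h : EuclideanSpace ℝ (Fin N)) :
    LocallyIntegrable (fun x => ∫ t in Ioc (0 : ℝ) 1, f (x + t • h)) volume := by
  rw [locallyIntegrable_iff]
  intro K hK
  obtain ⟨φ, hφ1, -, hφc, -⟩ := exists_continuous_one_zero_of_isCompact hK isClosed_empty
    (disjoint_empty K)
  have h1 := (integrable_mul_comp_add_smul hf φ.continuous hφc h).integral_prod_right
  refine (h1.integrableOn (s := K)).congr_fun (fun x hx => ?_) hK.measurableSet
  have : φ x = 1 := hφ1 hx
  simp [this]

lemma locallyIntegrable_comp_add_right (hf : LocallyIntegrable f volume)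
    (h : EuclideanSpace ℝ (Fin N)) : LocallyIntegrable (fun x => f (x + h)) volume := by
  have := (locallyIntegrable_map_homeomorph (Homeomorph.addRight h) (f := f) (μ := volume)).mp
    (by rw [Homeomorph.coe_addRight, map_add_right_eq_self]; exact hf)
  simpa [Function.comp_def] using this

lemma locallyIntegrable_inner_const (hG : LocallyIntegrable G volume)
    (h : EuclideanSpace ℝ (Fin N)) : LocallyIntegrable (fun x => inner ℝ (G x) h) volume := by
  have h1 : LocallyIntegrable (fun x => ‖h‖ • G x) volume := fun x => (hG x).smul ‖h‖
  refine h1.mono (hG.aestronglyMeasurable.inner aestronglyMeasurable_const)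
    (Eventually.of_forall fun x => ?_)
  rw [norm_smul, norm_norm, mul_comm]
  exact norm_inner_le_norm (𝕜 := ℝ) (G x) h

/-- A smooth function is the integral of its directional derivative along a segment. -/
lemma sub_eq_integral_fderiv (hφ : ContDiff ℝ ∞ φ) (y h : EuclideanSpace ℝ (Fin N)) :
    φ (y - h) - φ y = ∫ t in Ioc (0 : ℝ) 1, -(fderiv ℝ φ (y - t • h) h) := by
  have hd : ∀ t ∈ uIcc (0 : ℝ) 1,
      HasDerivAt (fun t : ℝ => φ (y - t • h)) (-(fderiv ℝ φ (y - t • h) h)) t := by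
    intro t _
    have h1 : HasDerivAt (fun t : ℝ => y - t • h) (-h) t := by
      simpa using ((hasDerivAt_id t).smul_const h).const_sub y
    have h2 := ((hφ.differentiable (by simp)) (y - t • h)).hasFDerivAt
    have h3 := h2.comp_hasDerivAt t h1
    rwa [map_neg] at h3
  have hc : Continuous fun t : ℝ => -(fderiv ℝ φ (y - t • h) h) :=
    (((hφ.continuous_fderiv (by simp)).comp (by fun_prop)).clm_apply continuous_const).neg
  have := intervalIntegral.integral_eq_sub_of_hasDerivAt hd (hc.intervalIntegrable 0 1)
  rw [intervalIntegral.integral_of_le zero_le_one] at this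
  simpa using this.symm

lemma IsTestFunction.comp_sub_const (hφ : IsTestFunction univ φ) (v : EuclideanSpace ℝ (Fin N)) :
    IsTestFunction univ fun x => φ (x - v) :=
  ⟨hφ.1.comp (contDiff_id.sub contDiff_const),
    hφ.2.1.comp_homeomorph (Homeomorph.subRight v), subset_univ _⟩

/-- Integrated form of the weak gradient identity along segments. -/
lemma HasWeakGradient.integral_mul_sub (hG : HasWeakGradient u G) (hφ : IsTestFunction univ φ)
    (h : EuclideanSpace ℝ (Fin N)) :
    ∫ x, φ x * (u (x + h) - u x) =
      ∫ x, φ x * ∫ t in Ioc (0 : ℝ) 1, inner ℝ (G (x + t • h)) h := by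
  obtain ⟨hu, hGl, hw⟩ := hG
  have hg : LocallyIntegrable (fun x => inner ℝ (G x) h) volume :=
    locallyIntegrable_inner_const hGl h
  have hφcont := hφ.1.continuous
  have i1 : Integrable (fun x => φ x * u (x + h)) volume :=
    (locallyIntegrable_comp_add_right hu h).integrable_smul_left_of_hasCompactSupport hφcont hφ.2.1
  have i2 : Integrable (fun x => φ x * u x) volume :=
    hu.integrable_smul_left_of_hasCompactSupport hφcont hφ.2.1
  have i3 : Integrable (fun x => φ (x - h) * u x) volume :=
    hu.integrable_smul_left_of_hasCompactSupport (hφ.comp_sub_const h).1.continuous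
      (hφ.comp_sub_const h).2.1
  have e1 : ∫ x, φ x * u (x + h) = ∫ x, φ (x - h) * u x := by
    have := integral_add_right_eq_self (μ := volume) (fun x => φ (x - h) * u x) h
    simpa using this
  have e2 : ∫ x, φ x * (u (x + h) - u x) = ∫ y, (φ (y - h) - φ y) * u y := by
    simp_rw [mul_sub, sub_mul]
    rw [integral_sub i1 i2, integral_sub i3 i2, e1]
  have hψ : Continuous fun x => -(fderiv ℝ φ x h) :=
    ((hφ.1.continuous_fderiv (by simp)).clm_apply continuous_const).neg
  have hψc : HasCompactSupport fun x => -(fderiv ℝ φ x h) := (hφ.2.1.fderiv_apply ℝ h).neg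
  rw [e2]
  calc ∫ y, (φ (y - h) - φ y) * u y
      = ∫ y, ∫ t in Ioc (0 : ℝ) 1, -(fderiv ℝ φ (y - t • h) h) * u y := by
        refine integral_congr_ae (Eventually.of_forall fun y => ?_)
        simp only
        rw [sub_eq_integral_fderiv hφ.1, integral_mul_const]
    _ = ∫ t in Ioc (0 : ℝ) 1, ∫ y, -(fderiv ℝ φ (y - t • h) h) * u y :=
        (integral_integral_swap (integrable_comp_sub_smul_mul hu hψ hψc h)).symm
    _ = ∫ t in Ioc (0 : ℝ) 1, ∫ y, φ y * inner ℝ (G (y + t • h)) h := by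
        congr 1; ext t
        have h1 := hw _ (hφ.comp_sub_const (t • h)) h
        have h2 : ∫ y, φ y * inner ℝ (G (y + t • h)) h =
            ∫ y, φ (y - t • h) * inner ℝ (G y) h := by
          have := integral_add_right_eq_self (μ := volume)
            (fun x => φ (x - t • h) * inner ℝ (G x) h) (t • h)
          simpa using this
        rw [h2, ← neg_eq_iff_eq_neg.mpr h1, ← integral_neg]
        congr 1; ext y
        rw [fderiv_comp_sub]
        ring
    _ = ∫ y, ∫ t in Ioc (0 : ℝ) 1, φ y * inner ℝ (G (y + t • h)) h :=
        integral_integral_swap (integrable_mul_comp_add_smul hg hφcont hφ.2.1 h)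
    _ = _ := by
        congr 1; ext y
        rw [integral_const_mul]

/-- Both sides are locally integrable and have equal integrals against every test function. -/
lemma HasWeakGradient.sub_ae_eq (hG : HasWeakGradient u G) (h : EuclideanSpace ℝ (Fin N)) :
    ∀ᵐ x, u (x + h) - u x = ∫ t in Ioc (0 : ℝ) 1, inner ℝ (G (x + t • h)) h := by
  have hg : LocallyIntegrable (fun x => inner ℝ (G x) h) volume :=
    locallyIntegrable_inner_const hG.2.1 h
  refine ae_eq_of_integral_contDiff_smul_eq
    ((locallyIntegrable_comp_add_right hG.1 h).sub hG.1)
    (locallyIntegrable_integral_segment hg h) fun φ hφ hφc => ?_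
  exact hG.integral_mul_sub ⟨hφ, hφc, subset_univ _⟩ h

/-- Jensen's inequality for powers. -/
lemma lintegral_rpow_le_of_isProbabilityMeasure {α : Type*} [MeasurableSpace α] {μ : Measure α}
    [IsProbabilityMeasure μ] {f : α → ℝ≥0∞} (hf : Measurable f) {p : ℝ} (hp : 1 ≤ p) :
    (∫⁻ x, f x ∂μ) ^ p ≤ ∫⁻ x, f x ^ p ∂μ := by
  have h := eLpNorm'_le_eLpNorm'_of_exponent_le one_pos hp μ hf.aestronglyMeasurable
  simp only [eLpNorm', enorm_eq_self, ENNReal.rpow_one, one_div, inv_one] at h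
  calc (∫⁻ x, f x ∂μ) ^ p ≤ ((∫⁻ x, f x ^ p ∂μ) ^ p⁻¹) ^ p := by gcongr
    _ = _ := ENNReal.rpow_inv_rpow (by linarith) _

lemma HasWeakGradient.congr {G' : EuclideanSpace ℝ (Fin N) → EuclideanSpace ℝ (Fin N)}
    (hG : HasWeakGradient u G) (hGG' : G =ᵐ[volume] G') : HasWeakGradient u G' := by
  refine ⟨hG.1, hG.2.1.congr hGG', fun φ hφ v => ?_⟩
  rw [hG.2.2 φ hφ v]
  congr 1
  refine integral_congr_ae ?_
  filter_upwards [hGG'] with x hx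
  rw [hx]

/-- Jensen's inequality along the segment, Tonelli with translation invariance, and the
Cauchy–Schwarz inequality. -/
lemma HasWeakGradient.translateMass_le_of_measurable (hG : HasWeakGradient u G)
    (hGm : Measurable G) {p : ℝ} (hp : 1 ≤ p) (h : EuclideanSpace ℝ (Fin N)) :
    translateMass u p h ≤ ‖h‖ₑ ^ p * ∫⁻ x, ‖G x‖ₑ ^ p := by
  have : IsProbabilityMeasure (volume.restrict (Ioc (0 : ℝ) 1)) := ⟨by simp⟩
  set g : EuclideanSpace ℝ (Fin N) → ℝ≥0∞ := fun x => ‖(inner ℝ (G x) h : ℝ)‖ₑ with hgdef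
  have hgm : Measurable g := (hGm.inner measurable_const).enorm
  have hadd : Measurable fun z : ℝ × EuclideanSpace ℝ (Fin N) => z.2 + z.1 • h :=
    measurable_snd.add (measurable_fst.smul_const h)
  calc translateMass u p h
      = ∫⁻ x, ‖∫ t in Ioc (0 : ℝ) 1, (inner ℝ (G (x + t • h)) h : ℝ)‖ₑ ^ p := by
        refine lintegral_congr_ae ?_
        filter_upwards [hG.sub_ae_eq h] with x hx
        rw [hx]
    _ ≤ ∫⁻ x, ∫⁻ t in Ioc (0 : ℝ) 1, g (x + t • h) ^ p := by
        refine lintegral_mono fun x => ?_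
        calc _ ≤ (∫⁻ t in Ioc (0 : ℝ) 1, g (x + t • h)) ^ p := by
              gcongr
              exact enorm_integral_le_lintegral_enorm _
          _ ≤ _ := lintegral_rpow_le_of_isProbabilityMeasure
              (hgm.comp (hadd.comp (measurable_id.prodMk measurable_const))) hp
    _ = ∫⁻ t in Ioc (0 : ℝ) 1, ∫⁻ x, g (x + t • h) ^ p :=
        (lintegral_lintegral_swap ((hgm.comp hadd).pow_const p).aemeasurable).symm
    _ = ∫⁻ t in Ioc (0 : ℝ) 1, ∫⁻ x, g x ^ p := by
        congr 1; ext t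
        exact lintegral_add_right_eq_self (fun x => g x ^ p) (t • h)
    _ = ∫⁻ x, g x ^ p := by simp
    _ ≤ ∫⁻ x, ‖h‖ₑ ^ p * ‖G x‖ₑ ^ p := by
        refine lintegral_mono fun x => ?_
        rw [← ENNReal.mul_rpow_of_nonneg _ _ (by linarith)]
        gcongr
        simp only [hgdef]
        rw [mul_comm, ← ofReal_norm, ← ofReal_norm, ← ofReal_norm,
          ← ENNReal.ofReal_mul (norm_nonneg _)]
        exact ENNReal.ofReal_le_ofReal (norm_inner_le_norm _ _)
    _ = _ := lintegral_const_mul' _ _ (by finiteness)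

lemma HasWeakGradient.translateMass_le (hG : HasWeakGradient u G) {p : ℝ} (hp : 1 ≤ p)
    (h : EuclideanSpace ℝ (Fin N)) :
    translateMass u p h ≤ ‖h‖ₑ ^ p * ∫⁻ x, ‖G x‖ₑ ^ p := by
  have hm := hG.2.1.aestronglyMeasurable
  refine ((hG.congr hm.ae_eq_mk).translateMass_le_of_measurable
    hm.stronglyMeasurable_mk.measurable hp h).trans_eq ?_
  congr 1
  refine lintegral_congr_ae ?_
  filter_upwards [hm.ae_eq_mk] with x hx
  rw [← hx]

end WeakGradient

/-! ### Comparison of the seminorms of different orders -/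

/-- The normalizing constant is comparable to `s (1 - s)`, uniformly in `p`. -/
lemma exists_cNsp_bounds {N : ℕ} (hN : 2 ≤ N) :
    ∃ a b : ℝ, 0 < a ∧ 0 < b ∧ ∀ s p : ℝ, 0 < s → s < 1 → 1 < p → p < N →
      a * (s * (1 - s)) ≤ cNsp N s p ∧ cNsp N s p ≤ b * (s * (1 - s)) := by
  have hN' : (2 : ℝ) ≤ N := by exact_mod_cast hN
  -- A compact interval of positive numbers containing both Gamma arguments, `(ps + p + N - 2)/2`
  -- and `2 - s`, for all admissible `s` and `p`.
  set I := Icc (1 / 2 : ℝ) (2 * N)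
  have hpos : ∀ x ∈ I, 0 < x := fun x hx => by have := hx.1; linarith
  have hcont : ContinuousOn Real.Gamma I := fun x hx =>
    (Real.differentiableAt_Gamma fun m => by
      have := hpos x hx; have := m.cast_nonneg (α := ℝ); linarith).continuousAt.continuousWithinAt
  have hne : I.Nonempty := ⟨1, by constructor <;> linarith⟩
  obtain ⟨x₀, hx₀, hmin⟩ := isCompact_Icc.exists_isMinOn hne hcont
  obtain ⟨x₁, hx₁, hmax⟩ := isCompact_Icc.exists_isMaxOn hne hcont
  set m := Real.Gamma x₀
  set M := Real.Gamma x₁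
  have hm : 0 < m := Real.Gamma_pos_of_pos (hpos x₀ hx₀)
  have hM : 0 < M := Real.Gamma_pos_of_pos (hpos x₁ hx₁)
  set π' := Real.pi ^ ((N : ℝ) / 2)
  have hπ : 0 < π' := Real.rpow_pos_of_pos Real.pi_pos _
  refine ⟨m / (π' * M), 4 * M / (π' * m), by positivity, by positivity, ?_⟩
  intro s p hs0 hs1 hp1 hpN
  have hsp : 0 < p * s := by positivity
  have hsp1 : p * s < N := by nlinarith
  have hA : (p * s + p + (N : ℝ) - 2) / 2 ∈ I := by constructor <;> linarith
  have hB : 2 - s ∈ I := by constructor <;> linarith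
  -- The functional equation isolates the factor `1 - s` hidden in the pole of Gamma at `0`.
  have hG2 : Real.Gamma (2 - s) = (1 - s) * Real.Gamma (1 - s) := by
    rw [show (2 : ℝ) - s = (1 - s) + 1 by ring, Real.Gamma_add_one (by linarith)]
  have h1s : 0 < 1 - s := by linarith
  have hc : cNsp N s p = (2 : ℝ) ^ (2 * s) * Real.Gamma ((p * s + p + (N : ℝ) - 2) / 2) /
      (π' * Real.Gamma (2 - s)) * (s * (1 - s)) := by
    have hG1 : 0 < Real.Gamma (1 - s) := Real.Gamma_pos_of_pos h1s
    rw [hG2, cNsp]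
    simp only [π'] at hπ ⊢
    field_simp
  have hp2 : (2 : ℝ) ^ (2 * s) ≤ 4 := by
    calc (2 : ℝ) ^ (2 * s) ≤ 2 ^ (2 : ℝ) :=
          Real.rpow_le_rpow_of_exponent_le one_le_two (by linarith)
      _ = 4 := by norm_num
  have hp3 : 1 ≤ (2 : ℝ) ^ (2 * s) := Real.one_le_rpow one_le_two (by linarith)
  have hA1 := hmin hA
  have hA2 := hmax hA
  have hB1 := hmin hB
  have hB2 := hmax hB
  simp only [mem_ofPred_eq] at hA1 hA2 hB1 hB2
  set A := Real.Gamma ((p * s + p + (N : ℝ) - 2) / 2)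
  have hA0 : 0 < A := hm.trans_le hA1
  have hB0 : 0 < Real.Gamma (2 - s) := hm.trans_le hB1
  rw [hc]
  constructor
  · gcongr
    calc m ≤ 1 * A := by rw [one_mul]; exact hA1
      _ ≤ _ := by gcongr
  · gcongr

section Seminorm

variable {N : ℕ} {u v : EuclideanSpace ℝ (Fin N) → ℝ} {s S p R : ℝ}

lemma fracSeminorm_zero_rpow (hp : 0 < p) : fracSeminorm 0 p u ^ p = ∫⁻ x, ‖u x‖ₑ ^ p := by
  rw [fracSeminorm, if_pos rfl, eLpNorm_eq_lintegral_rpow_enorm_toReal (by simpa using hp)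
    ENNReal.ofReal_ne_top, ENNReal.toReal_ofReal hp.le, one_div, ENNReal.rpow_inv_rpow hp.ne']

lemma fracSeminorm_rpow (hs0 : 0 < s) (hs1 : s < 1) (hp : 0 < p) :
    fracSeminorm s p u ^ p = ENNReal.ofReal (cNsp N s p) * gagliardo s p u := by
  rw [fracSeminorm, if_neg hs0.ne', if_neg hs1.ne, one_div, ENNReal.rpow_inv_rpow hp.ne',
    gagliardo]

lemma gradNorm_congr (huv : u =ᵐ[volume] v) : gradNorm p u = gradNorm p v := by
  have key : ∀ {u v : EuclideanSpace ℝ (Fin N) → ℝ}, u =ᵐ[volume] v → ∀ {G},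
      HasWeakGradient u G → HasWeakGradient v G := by
    intro u v huv G hG
    refine ⟨hG.1.congr huv, hG.2.1, fun φ hφ w => ?_⟩
    rw [← hG.2.2 φ hφ w]
    refine integral_congr_ae ?_
    filter_upwards [huv] with x hx
    rw [hx]
  unfold gradNorm
  refine iInf_congr fun G => ?_
  rw [propext ⟨key huv, key huv.symm⟩]

lemma fracSeminorm_congr (huv : u =ᵐ[volume] v) : fracSeminorm s p u = fracSeminorm s p v := by
  have hg : ∀ᵐ z : EuclideanSpace ℝ (Fin N) × EuclideanSpace ℝ (Fin N),
      ENNReal.ofReal (|u z.1 - u z.2| ^ p / ‖z.1 - z.2‖ ^ ((N : ℝ) + s * p)) =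
      ENNReal.ofReal (|v z.1 - v z.2| ^ p / ‖z.1 - z.2‖ ^ ((N : ℝ) + s * p)) := by
    rw [Measure.volume_eq_prod]
    filter_upwards [Measure.quasiMeasurePreserving_fst.ae huv,
      Measure.quasiMeasurePreserving_snd.ae huv] with z h1 h2
    rw [h1, h2]
  unfold fracSeminorm
  rw [eLpNorm_congr_ae huv, gradNorm_congr huv, lintegral_congr_ae hg]

lemma ofReal_mul_le_fracSeminorm_rpow {a : ℝ} (ha : 0 < a) (hs0 : 0 < s) (hs1 : s < 1)
    (hp : 0 < p) (hac : a * (s * (1 - s)) ≤ cNsp N s p) :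
    ENNReal.ofReal (s * (1 - s)) * gagliardo s p u ≤
      ENNReal.ofReal a⁻¹ * fracSeminorm s p u ^ p := by
  rw [fracSeminorm_rpow hs0 hs1 hp, ← mul_assoc, ← ENNReal.ofReal_mul (by positivity)]
  gcongr ENNReal.ofReal ?_ * _
  rwa [le_inv_mul_iff₀ ha]

lemma fracSeminorm_rpow_le {b : ℝ} (hb : 0 < b) (hs0 : 0 < s) (hs1 : s < 1)
    (hp : 0 < p) (hcb : cNsp N s p ≤ b * (s * (1 - s))) :
    fracSeminorm s p u ^ p ≤
      ENNReal.ofReal b * (ENNReal.ofReal (s * (1 - s)) * gagliardo s p u) := by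
  rw [fracSeminorm_rpow hs0 hs1 hp, ← mul_assoc, ← ENNReal.ofReal_mul hb.le]
  gcongr

/-- Comparison with a seminorm of fractional order. -/
lemma exists_fracSeminorm_le_of_lt_one (hN : 2 ≤ N) (hR : 1 ≤ R) :
    ∃ C : ℝ≥0∞, C ≠ ⊤ ∧ ∀ (s S p : ℝ) (u : EuclideanSpace ℝ (Fin N) → ℝ), Measurable u →
      (∀ᵐ x, x ∉ Metric.ball 0 R → u x = 0) → 0 ≤ s → s < S → S < 1 → 1 < p → p < N →
      fracSeminorm s p u ^ p ≤ C * fracSeminorm S p u ^ p := by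
  obtain ⟨a, b, ha, hb, hab⟩ := exists_cNsp_bounds hN
  have hN0 : 0 < N := by omega
  have hα0 := volume_annulus_ne_zero hN0 (zero_lt_one.trans_le hR)
  have hαt := volume_annulus_ne_top (N := N) R
  set α := volume (annulus N R)
  set D : ℝ≥0∞ := ENNReal.ofReal (4 * R) ^ (2 * N) * ENNReal.ofReal a⁻¹
  set C₁ : ℝ≥0∞ := α⁻¹ * (N * 2 ^ N) * D
  set C₂ : ℝ≥0∞ := ENNReal.ofReal b * (2 * N + 2 * 2 ^ N * (N * 2 ^ N)) * D
  refine ⟨C₁ + C₂, by finiteness, ?_⟩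
  intro s S p u hu hsupp hs0 hsS hS1 hp hpN
  have hS0 : 0 < S := hs0.trans_lt hsS
  have hp0 : 0 < p := by linarith
  set V := shellMass u p R
  set L := ∫⁻ x, ‖u x‖ₑ ^ p
  have hV : ∀ k, V (k + 1) ≤ 2 ^ p * V k := shellMass_succ_le hu hp.le
  have haV : ∀ n : ℕ, α * L ≤ V n := le_shellMass hp0 hsupp
  have hVa : ∀ n : ℕ, V n ≤ 2 ^ N * (α * L) := fun n => shellMass_le hu hp.le hpN.le n
  have hD : ENNReal.ofReal (S * (1 - S)) * dyadicSum V S p ≤ D * fracSeminorm S p u ^ p := by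
    calc _ ≤ ENNReal.ofReal (S * (1 - S)) *
          (ENNReal.ofReal (4 * R) ^ (2 * N) * gagliardo S p u) := by
          gcongr
          exact dyadicSum_le_gagliardo hN0 hR hu hp0.le hpN.le hS0.le hS1.le
      _ = ENNReal.ofReal (4 * R) ^ (2 * N) *
          (ENNReal.ofReal (S * (1 - S)) * gagliardo S p u) := by ring
      _ ≤ ENNReal.ofReal (4 * R) ^ (2 * N) *
          (ENNReal.ofReal a⁻¹ * fracSeminorm S p u ^ p) := by
          gcongr _ * ?_
          exact ofReal_mul_le_fracSeminorm_rpow ha hS0 hS1 hp0 (hab S p hS0 hS1 hp hpN).1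
      _ = _ := by rw [← mul_assoc]
  rw [add_mul]
  rcases hs0.eq_or_lt with rfl | hs0
  · refine le_add_right ?_
    rw [fracSeminorm_zero_rpow hp0]
    calc L = α⁻¹ * (α * L) := by rw [← mul_assoc, ENNReal.inv_mul_cancel hα0 hαt, one_mul]
      _ ≤ α⁻¹ * (N * 2 ^ N * (D * fracSeminorm S p u ^ p)) := by
          gcongr _ * ?_
          exact (le_mul_dyadicSum hp.le hpN.le hS0 hS1 hV haV).trans (by gcongr)
      _ = _ := by simp only [C₁]; ring
  · refine le_add_left ?_
    have hs1 : s < 1 := hsS.trans hS1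
    calc _ ≤ ENNReal.ofReal b * (ENNReal.ofReal (s * (1 - s)) * gagliardo s p u) :=
          fracSeminorm_rpow_le hb hs0 hs1 hp0 (hab s p hs0 hs1 hp hpN).2
      _ ≤ ENNReal.ofReal b * (ENNReal.ofReal (s * (1 - s)) * dyadicSum V s p) := by
          gcongr
          exact gagliardo_le_dyadicSum hN0 hR hu hp0.le hs0.le
      _ ≤ ENNReal.ofReal b * ((2 * N + 2 * 2 ^ N * (N * 2 ^ N)) *
            (D * fracSeminorm S p u ^ p)) := by
          gcongr _ * ?_
          exact (ofReal_mul_dyadicSum_le hp.le hpN.le hs0 hsS.le hS1 hV haV hVa).trans (by gcongr)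
      _ = _ := by simp only [C₂]; ring

/-- Comparison with the norm of the weak gradient. -/
lemma exists_fracSeminorm_le_gradient (hN : 2 ≤ N) (hR : 1 ≤ R) :
    ∃ C : ℝ≥0∞, C ≠ ⊤ ∧ ∀ (s p : ℝ) (u : EuclideanSpace ℝ (Fin N) → ℝ)
      (G : EuclideanSpace ℝ (Fin N) → EuclideanSpace ℝ (Fin N)), Measurable u →
      (∀ᵐ x, x ∉ Metric.ball 0 R → u x = 0) → 0 ≤ s → s < 1 → 1 < p → p < N →
      HasWeakGradient u G → fracSeminorm s p u ^ p ≤ C * ∫⁻ x, ‖G x‖ₑ ^ p := by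
  obtain ⟨a, b, ha, hb, hab⟩ := exists_cNsp_bounds hN
  have hN0 : 0 < N := by omega
  have hα0 := volume_annulus_ne_zero hN0 (zero_lt_one.trans_le hR)
  have hαt := volume_annulus_ne_top (N := N) R
  set α := volume (annulus N R)
  set C₁ : ℝ≥0∞ := ENNReal.ofReal (4 * R) ^ N
  set C₂ : ℝ≥0∞ := ENNReal.ofReal b * (2 + 2 * 2 ^ N) * (α * C₁)
  refine ⟨C₁ + C₂, by finiteness, ?_⟩
  intro s p u G hu hsupp hs0 hs1 hp hpN hG
  have hp0 : 0 < p := by linarith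
  set V := shellMass u p R
  set L := ∫⁻ x, ‖u x‖ₑ ^ p
  set K := ∫⁻ x, ‖G x‖ₑ ^ p
  have hM : ∀ n, smallScales V p n ≤ α * (C₁ * K) :=
    smallScales_shellMass_le hp0.le hpN.le hR (hG.translateMass_le hp.le)
  have haM : α * L ≤ α * (C₁ * K) := by
    refine (le_shellMass hp0 hsupp 0).trans (le_trans ?_ (hM 0))
    simp [smallScales, V]
  rw [add_mul]
  rcases hs0.eq_or_lt with rfl | hs0
  · refine le_add_right ?_
    rw [fracSeminorm_zero_rpow hp0]
    exact (ENNReal.mul_le_mul_iff_right hα0 hαt).mp haM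
  · refine le_add_left ?_
    calc _ ≤ ENNReal.ofReal b * (ENNReal.ofReal (s * (1 - s)) * gagliardo s p u) :=
          fracSeminorm_rpow_le hb hs0 hs1 hp0 (hab s p hs0 hs1 hp hpN).2
      _ ≤ ENNReal.ofReal b * (ENNReal.ofReal (s * (1 - s)) * dyadicSum V s p) := by
          gcongr
          exact gagliardo_le_dyadicSum hN0 hR hu hp0.le hs0.le
      _ ≤ ENNReal.ofReal b * ((2 + 2 * 2 ^ N) * (α * (C₁ * K))) := by
          gcongr _ * ?_
          exact ofReal_mul_dyadicSum_le_of_bdd hp.le hs0 hs1 hM haM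
            fun n => shellMass_le hu hp.le hpN.le n
      _ = _ := by simp only [C₂]; ring

/-- Seminorms of lower order are controlled by those of higher order, for functions vanishing
outside a bounded set, with a constant uniform in the orders and in the exponent. -/
theorem exists_fracSeminorm_rpow_le (hN : 2 ≤ N) {Ω : Set (EuclideanSpace ℝ (Fin N))}
    (hΩ : Bornology.IsBounded Ω) :
    ∃ C : ℝ≥0∞, C ≠ ⊤ ∧ ∀ (s S p : ℝ) (u : EuclideanSpace ℝ (Fin N) → ℝ),
      AEStronglyMeasurable u volume → (∀ᵐ x, x ∉ Ω → u x = 0) →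
      0 ≤ s → s < S → S ≤ 1 → 1 < p → p < N →
      fracSeminorm s p u ^ p ≤ C * fracSeminorm S p u ^ p := by
  obtain ⟨R, hR, hΩR⟩ := hΩ.subset_ball_lt 1 (0 : EuclideanSpace ℝ (Fin N))
  obtain ⟨C₁, hC₁, h₁⟩ := exists_fracSeminorm_le_of_lt_one hN hR.le
  obtain ⟨C₂, hC₂, h₂⟩ := exists_fracSeminorm_le_gradient hN hR.le
  -- The summand `1` makes the constant nonzero, so that it can be divided out when `S = 1`.
  refine ⟨C₁ + C₂ + 1, by finiteness, ?_⟩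
  intro s S p u hu hsupp hs0 hsS hS1 hp hpN
  have hp0 : 0 < p := by linarith
  have huv := hu.ae_eq_mk
  have hv : Measurable (hu.mk u) := hu.stronglyMeasurable_mk.measurable
  have hsuppv : ∀ᵐ x, x ∉ Metric.ball 0 R → hu.mk u x = 0 := by
    filter_upwards [hsupp, huv] with x hx hx' hxR
    rw [← hx', hx fun hxΩ => hxR (hΩR hxΩ)]
  rw [fracSeminorm_congr huv, fracSeminorm_congr huv]
  generalize hu.mk u = v at hv hsuppv
  rcases hS1.lt_or_eq with hS1 | rfl
  · refine (h₁ s S p v hv hsuppv hs0 hsS hS1 hp hpN).trans ?_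
    gcongr
    rw [add_assoc]; exact le_self_add
  · set C := C₁ + C₂ + 1
    have hC0 : C ≠ 0 := by simp [C]
    have hCt : C ≠ ⊤ := by finiteness
    -- In this form the bound passes to the infimum defining `gradNorm`, including the empty case
    -- where it is `∞`.
    have key : (C⁻¹ * fracSeminorm s p v ^ p) ^ p⁻¹ ≤ fracSeminorm 1 p v := by
      rw [fracSeminorm.eq_def 1, if_neg one_ne_zero, if_pos rfl, gradNorm]
      refine le_iInf₂ fun G hG => ?_
      rw [eLpNorm_eq_lintegral_rpow_enorm_toReal (by simpa using hp0) ENNReal.ofReal_ne_top,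
        ENNReal.toReal_ofReal hp0.le, one_div]
      gcongr
      rw [mul_comm, ← div_eq_mul_inv, ENNReal.div_le_iff' hC0 hCt]
      refine (h₂ s p v G hv hsuppv hs0 hsS hp hpN hG).trans ?_
      gcongr
      exact le_add_right le_add_self
    rw [ENNReal.rpow_inv_le_iff hp0] at key
    rwa [mul_comm, ← div_eq_mul_inv, ENNReal.div_le_iff' hC0 hCt] at key

end Seminorm

/-! ### Superposition -/

/-- The supremum `f p` of `F (s, p)` over `s ∈ A` bounds `F` on `A` from above and is at most `C * F
(S, p)` for each `S ∈ B`. As it depends on `p` alone, the product integrals reduce to `ν A` and `μ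
B` times `∫ f`. -/
lemma setLIntegral_prod_le_of_le {α β : Type*} [MeasurableSpace α] [MeasurableSpace β]
    {μ ν : Measure α} {ρ : Measure β} [SFinite μ] [SFinite ν] [SFinite ρ] {A B : Set α} {I : Set β}
    (hA : MeasurableSet A) (hB : MeasurableSet B) (hI : MeasurableSet I) {F : α × β → ℝ≥0∞}
    {C γ : ℝ≥0∞} (hC : C ≠ ⊤)
    (hF : ∀ s ∈ A, ∀ S ∈ B, ∀ p ∈ I, F (s, p) ≤ C * F (S, p)) (hAB : ν A ≤ γ * μ B) :
    ∫⁻ z in A ×ˢ I, F z ∂(ν.prod ρ) ≤ C * γ * ∫⁻ z in B ×ˢ I, F z ∂(μ.prod ρ) := by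
  set f : β → ℝ≥0∞ := fun p => ⨆ s ∈ A, F (s, p)
  -- The supremum may fail to be measurable; a measurable minorant with the same integral permits
  -- Tonelli in the lower bound, while the upper bound needs only the inequality
  -- `lintegral_prod_le`.
  obtain ⟨g, hgm, hgf, hfg⟩ := exists_measurable_le_lintegral_eq (ρ.restrict I) f
  have h1 : ∫⁻ z in A ×ˢ I, F z ∂(ν.prod ρ) ≤ ν A * ∫⁻ p in I, f p ∂ρ := by
    calc _ ≤ ∫⁻ z in A ×ˢ I, f z.2 ∂(ν.prod ρ) :=
          setLIntegral_mono' (hA.prod hI) fun z hz =>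
            le_iSup₂_of_le (f := fun s _ => F (s, z.2)) z.1 hz.1 le_rfl
      _ ≤ ∫⁻ _ in A, ∫⁻ p in I, f p ∂ρ ∂ν := by
          rw [← Measure.prod_restrict]
          exact lintegral_prod_le _
      _ = _ := by rw [setLIntegral_const, mul_comm]
  have h2 : μ B * ∫⁻ p in I, f p ∂ρ ≤ C * ∫⁻ z in B ×ˢ I, F z ∂(μ.prod ρ) := by
    calc _ = ∫⁻ z in B ×ˢ I, g z.2 ∂(μ.prod ρ) := by
          rw [← Measure.prod_restrict, lintegral_prod (fun z => g z.2)
            (hgm.comp measurable_snd).aemeasurable, hfg]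
          simp only [setLIntegral_const]
          rw [mul_comm]
      _ ≤ ∫⁻ z in B ×ˢ I, C * F z ∂(μ.prod ρ) :=
          setLIntegral_mono' (hB.prod hI) fun z hz =>
            (hgf z.2).trans (iSup₂_le fun s hs => hF s hs z.1 hz.1 z.2 hz.2)
      _ = _ := lintegral_const_mul' _ _ hC
  calc _ ≤ (γ * μ B) * ∫⁻ p in I, f p ∂ρ := h1.trans (by gcongr)
    _ = γ * (μ B * ∫⁻ p in I, f p ∂ρ) := mul_assoc _ _ _
    _ ≤ γ * (C * ∫⁻ z in B ×ˢ I, F z ∂(μ.prod ρ)) := by gcongr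
    _ = _ := by ring

/-- On a set that is null for `ν`, integrating against `μ - ν` is integrating against `μ`. -/
lemma signedIntegral_sub_of_null {α : Type*} [MeasurableSpace α] {μ ν : Measure α}
    [IsFiniteMeasure μ] [IsFiniteMeasure ν] {A : Set α} (hA : MeasurableSet A) (hν : ν A = 0)
    (f : α → ℝ≥0∞) :
    signedIntegral (μ.toSignedMeasure - ν.toSignedMeasure) A f =
      ((∫⁻ z in A, f z ∂μ : ℝ≥0∞) : EReal) := by
  -- The Jordan parts of `μ - ν` are the truncated differences of the two measures, which on `A`
  -- reduce to `μ` and `0`.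
  have hν' : ν.restrict A = 0 := Measure.restrict_eq_zero.mpr hν
  rw [signedIntegral, Measure.toJordanDecomposition_toSignedMeasure_sub,
    Measure.jordanDecompositionOfToSignedMeasureSub_posPart,
    Measure.jordanDecompositionOfToSignedMeasureSub_negPart,
    Measure.restrict_sub_eq_restrict_sub_restrict hA,
    Measure.restrict_sub_eq_restrict_sub_restrict hA, hν', Measure.sub_zero, Measure.zero_sub]
  simp

theorem theorem2p6 (N : ℕ) (hN : 2 ≤ N) (Ω : Set (EuclideanSpace ℝ (Fin N)))
    (hΩ_open : IsOpen Ω) (hΩ_bdd : Bornology.IsBounded Ω) :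
    ∃ c₀ : ℝ, 0 < c₀ ∧
      ∀ (μplus μminus : Measure (ℝ × ℝ)) [IsFiniteMeasure μplus] [IsFiniteMeasure μminus]
        (μsplus μsminus μp : Measure ℝ)
        [IsFiniteMeasure μsplus] [IsFiniteMeasure μsminus] [IsFiniteMeasure μp]
        (sbar γ δ η : ℝ),
        -- the factors are measures on `[0,1]` and on `(1,N)`
        μsplus (Icc 0 1)ᶜ = 0 → μsminus (Icc 0 1)ᶜ = 0 → μp (Ioo 1 (N : ℝ))ᶜ = 0 →
        -- product structure
        μplus = μsplus.prod μp → μminus = μsminus.prod μp →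
        0 < sbar → sbar ≤ 1 → 0 ≤ γ → 0 < δ → 0 < η →
        0 < μplus (Icc sbar 1 ×ˢ Ioo 1 (N : ℝ)) →
        μminus (Icc sbar 1 ×ˢ Ioo 1 (N : ℝ)) = 0 →
        μsminus (Ico 0 sbar) ≤ ENNReal.ofReal γ * μsplus (Icc sbar 1) →
        μp.support ⊆ Icc (1 + δ) ((N : ℝ) - η) →
        ∀ u ∈ spaceX Ω μplus,
          ((∫⁻ z in Ico 0 sbar ×ˢ Ioo 1 (N : ℝ),
              fracSeminorm z.1 z.2 u ^ z.2 ∂μminus : ℝ≥0∞) : EReal) ≤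
            ((c₀ * γ : ℝ) : EReal) *
              signedIntegral (μplus.toSignedMeasure - μminus.toSignedMeasure)
                (Icc sbar 1 ×ˢ Ioo 1 (N : ℝ)) (fun z => fracSeminorm z.1 z.2 u ^ z.2) := by
  obtain ⟨C, hC, hle⟩ := exists_fracSeminorm_rpow_le hN hΩ_bdd
  -- Adding `1` makes the constant strictly positive.
  refine ⟨C.toReal + 1, by positivity, ?_⟩
  intro μplus μminus _ _ μsplus μsminus μp _ _ _ sbar γ δ η _ _ _ hplus hminus hs0 hs1 hγ _ _ _
    hnull hdom _ u hu
  have hbound := setLIntegral_prod_le_of_le (μ := μsplus) (ν := μsminus) (ρ := μp)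
    (A := Ico 0 sbar) (B := Icc sbar 1) (I := Ioo 1 (N : ℝ))
    (F := fun z => fracSeminorm z.1 z.2 u ^ z.2) measurableSet_Ico measurableSet_Icc
    measurableSet_Ioo hC
    (fun s hs S hS p hp => hle s S p u hu.1 hu.2.1 hs.1 (hs.2.trans_le hS.1) hS.2 hp.1 hp.2) hdom
  rw [← hplus, ← hminus] at hbound
  rw [signedIntegral_sub_of_null (measurableSet_Icc.prod measurableSet_Ioo) hnull]
  have hconst : (((C.toReal + 1) * γ : ℝ) : EReal) =
      ((ENNReal.ofReal ((C.toReal + 1) * γ) : ℝ≥0∞) : EReal) := by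
    rw [EReal.coe_ennreal_ofReal, max_eq_left (by positivity)]
  rw [hconst, ← EReal.coe_ennreal_mul, EReal.coe_ennreal_le_coe_ennreal_iff]
  refine hbound.trans ?_
  rw [ENNReal.ofReal_mul (by positivity)]
  gcongr
  exact (ENNReal.le_ofReal_iff_toReal_le hC (by positivity)).mpr (by linarith)
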